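/- Let $U\subseteq\mathbb R^2$ be open; all coefficients below are smooth ($C^\infty$) functions of $(x,y)\in U$, and subscripts $x,y$ on them denote partial derivatives. Consider the fourth-order ODE, quadratic in $y''$, $$y''''+(Q_1y'-Q_0)y''^2-(R_4y'^4-R_3y'^3+R_2y'^2-R_1y'+R_0)y''-(S_6y'^6-S_5y'^5+S_4y'^4-S_3y'^3+S_2y'^2-S_1y'+S_0)=0\qquad(\mathrm F)$$ and the second-order (root) equation $$y''+c\,y'^3-g\,y'^2+h\,y'-d=0.\qquad(\mathrm E)$$ (1) (F) is obtained from (E) by differentiating (E) twice with respect to $x$ and eliminating $y'''$ by means of the once differentiated equation if and only if the following three conditions hold on $U$. (a) Identification of $c,g,h$: $c=Q_1/6$, $g=Q_0/2$ and $Q_1h=R_2-Q_0^2+Q_{1x}-\tfrac52Q_{0y}$ (so $h=(R_2-Q_0^2+Q_{1x}-\tfrac52Q_{0y})/Q_1$ wherever $Q_1\ne0$). (b) Integral for $d$: $d=\int(R_0-h^2+2h_x)\,dy+k(x)$, i.e. $d(x,y_2)-d(x,y_1)=\int_{y_1}^{y_2}(R_0-h^2+2h_x)(x,t)\,dt$ whenever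 the segment from $(x,y_1)$ to $(x,y_2)$ lies in $U$. (c) Constraints: $$R_4=\tfrac14Q_1^2,\quad R_3=Q_1Q_0+\tfrac76Q_{1y},\quad R_1=2Q_0h+3h_y-2Q_{0x},\quad S_6=\tfrac1{12}Q_1Q_{1y},$$ $$S_5=-\tfrac1{12}Q_1Q_{1x}+\tfrac16Q_0Q_{1y}+\tfrac14Q_1Q_{0y}+\tfrac16Q_{1yy},$$ $$S_4=-\tfrac16Q_0Q_{1x}+\tfrac16hQ_{1y}-\tfrac14Q_1Q_{0x}+\tfrac12Q_0Q_{0y}+\tfrac12Q_1h_y-\tfrac13Q_{1xy}+\tfrac12Q_{0yy},$$ $$S_3=\tfrac12Q_1(R_0-h^2+h_x)-\tfrac16hQ_{1x}-\tfrac12Q_0Q_{0x}+\tfrac12hQ_{0y}+Q_0h_y+\tfrac16Q_{1xx}-Q_{0xy}+h_{yy},$$ $$S_2=-\tfrac12Q_1d_x+Q_0(R_0-h^2+h_x)-hh_y-\tfrac12hQ_{0x}+R_{0y}+\tfrac12Q_{0xx},$$ $$S_1=h(R_0-h^2+5h_x)-2R_{0x}-Q_0d_x-3h_{xx},\qquad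 S_0=d_{xx}-hd_x.$$ (2) Suppose that (a), (b), (c) and the Lie–Tresse criteria $$3(ch)_x+3dc_y+6cd_y-2gg_x-gh_y-3c_{xx}-2g_{xy}-h_{yy}=0,$$ $$3(dg)_y+3cd_x+6dc_x-2hh_y-hg_x-3d_{yy}-2h_{xy}-g_{xx}=0$$ hold on $U$. Then (F) is conditionally linearizable with root equation (E): every solution of (E) is a solution of (F), and near every point of $U$ a smooth invertible point transformation $(x,y)\mapsto(X,Y)$ takes (E) to the linear equation $d^2Y/dX^2=0$. Moreover the Christoffel symbols are consistent with a metric: near every point of $U$ there are smooth $a,b,e,f$ with $h=a-2e$, $g=f-2b$ such that $\Gamma^1_{11}=-a$, $\Gamma^1_{12}=-b$, $\Gamma^1_{22}=-c$, $\Gamma^2_{11}=-d$, $\Gamma^2_{12}=-e$, $\Gamma^2_{22}=-f$ are the Christoffel symbols of a smooth nondegenerate flat metric $p\,dx^2+2q\,dx\,dy+r\,dy^2$. (3) If $Q_0$ and $Q_1$ do not both vanish identically on $U$, then the left-hand side of (F) is not a total derivative, i.e. it is not of the form $\frac{d}{dx}G(x,y,y',y'',y''')$ with $G$ of class $C^1$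 on the space of 3-jets over $U$. -/

import Mathlib

open scoped ContDiff

noncomputable section

namespace CondLin

/-- Partial derivative with respect to the first variable `x`. -/
def dx (f : ℝ × ℝ → ℝ) (z : ℝ × ℝ) : ℝ := deriv (fun t => f (t, z.2)) z.1

/-- Partial derivative with respect to the second variable `y`. -/
def dy (f : ℝ × ℝ → ℝ) (z : ℝ × ℝ) : ℝ := deriv (fun t => f (z.1, t)) z.2

/-- The coefficients of a root equation `y'' + c y'^3 - g y'^2 + h y' - d = 0`. -/
structure RootODE where
  c : ℝ × ℝ → ℝ
  g : ℝ × ℝ → ℝ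
  h : ℝ × ℝ → ℝ
  d : ℝ × ℝ → ℝ

/-- The coefficients of the fourth-order equation, quadratic in `y''`,
`y'''' + (Q₁ y' - Q₀) y''^2 - (R₄ y'^4 - R₃ y'^3 + R₂ y'^2 - R₁ y' + R₀) y''
  - (S₆ y'^6 - S₅ y'^5 + S₄ y'^4 - S₃ y'^3 + S₂ y'^2 - S₁ y' + S₀) = 0`. -/
structure QuadODE where
  Q0 : ℝ × ℝ → ℝ
  Q1 : ℝ × ℝ → ℝ
  R0 : ℝ × ℝ → ℝ
  R1 : ℝ × ℝ → ℝ
  R2 : ℝ × ℝ → ℝ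
  R3 : ℝ × ℝ → ℝ
  R4 : ℝ × ℝ → ℝ
  S0 : ℝ × ℝ → ℝ
  S1 : ℝ × ℝ → ℝ
  S2 : ℝ × ℝ → ℝ
  S3 : ℝ × ℝ → ℝ
  S4 : ℝ × ℝ → ℝ
  S5 : ℝ × ℝ → ℝ
  S6 : ℝ × ℝ → ℝ

/-- The coefficients of the root equation are smooth on `U`. -/
def RootODE.SmoothOn (E : RootODE) (U : Set (ℝ × ℝ)) : Prop :=
  ContDiffOn ℝ ∞ E.c U ∧ ContDiffOn ℝ ∞ E.g U ∧ ContDiffOn ℝ ∞ E.h U ∧ ContDiffOn ℝ ∞ E.d U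

/-- The coefficients of the fourth-order equation are smooth on `U`. -/
def QuadODE.SmoothOn (F : QuadODE) (U : Set (ℝ × ℝ)) : Prop :=
  (ContDiffOn ℝ ∞ F.Q0 U ∧ ContDiffOn ℝ ∞ F.Q1 U) ∧
  (ContDiffOn ℝ ∞ F.R0 U ∧ ContDiffOn ℝ ∞ F.R1 U ∧ ContDiffOn ℝ ∞ F.R2 U ∧
    ContDiffOn ℝ ∞ F.R3 U ∧ ContDiffOn ℝ ∞ F.R4 U) ∧
  (ContDiffOn ℝ ∞ F.S0 U ∧ ContDiffOn ℝ ∞ F.S1 U ∧ ContDiffOn ℝ ∞ F.S2 U ∧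
    ContDiffOn ℝ ∞ F.S3 U ∧ ContDiffOn ℝ ∞ F.S4 U ∧ ContDiffOn ℝ ∞ F.S5 U ∧
    ContDiffOn ℝ ∞ F.S6 U)

/-- The left-hand side of the root equation along the curve `x ↦ (x, y x)`. -/
def RootODE.lhs (E : RootODE) (y : ℝ → ℝ) (x : ℝ) : ℝ :=
  iteratedDeriv 2 y x + E.c (x, y x) * deriv y x ^ 3 - E.g (x, y x) * deriv y x ^ 2
    + E.h (x, y x) * deriv y x - E.d (x, y x)

/-- The left-hand side of the fourth-order equation along the curve `x ↦ (x, y x)`. -/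
def QuadODE.lhs (F : QuadODE) (y : ℝ → ℝ) (x : ℝ) : ℝ :=
  iteratedDeriv 4 y x
    + (F.Q1 (x, y x) * deriv y x - F.Q0 (x, y x)) * iteratedDeriv 2 y x ^ 2
    - (F.R4 (x, y x) * deriv y x ^ 4 - F.R3 (x, y x) * deriv y x ^ 3
        + F.R2 (x, y x) * deriv y x ^ 2 - F.R1 (x, y x) * deriv y x + F.R0 (x, y x))
      * iteratedDeriv 2 y x
    - (F.S6 (x, y x) * deriv y x ^ 6 - F.S5 (x, y x) * deriv y x ^ 5
        + F.S4 (x, y x) * deriv y x ^ 4 - F.S3 (x, y x) * deriv y x ^ 3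
        + F.S2 (x, y x) * deriv y x ^ 2 - F.S1 (x, y x) * deriv y x + F.S0 (x, y x))

/-- `y` is a solution on the open set `I`, with graph in `U`, of the root equation. -/
def RootODE.IsSolution (U : Set (ℝ × ℝ)) (E : RootODE) (I : Set ℝ) (y : ℝ → ℝ) : Prop :=
  IsOpen I ∧ ContDiffOn ℝ 2 y I ∧ (∀ x ∈ I, (x, y x) ∈ U) ∧ ∀ x ∈ I, E.lhs y x = 0

/-- `y` is a solution on the open set `I`, with graph in `U`, of the fourth-order equation. -/
def QuadODE.IsSolution (U : Set (ℝ × ℝ)) (F : QuadODE) (I : Set ℝ) (y : ℝ → ℝ) : Prop :=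
  IsOpen I ∧ ContDiffOn ℝ 4 y I ∧ (∀ x ∈ I, (x, y x) ∈ U) ∧ ∀ x ∈ I, F.lhs y x = 0

/-- The fourth-order equation is obtained from the root equation by differentiating it twice and
eliminating `y'''` with the help of the once differentiated equation. Since the left-hand side of
the fourth-order equation does not contain `y'''`, this says that it agrees with the second total
derivative of the left-hand side of the root equation at every jet at which the first total
derivative vanishes. -/
def ArisesFrom (U : Set (ℝ × ℝ)) (F : QuadODE) (E : RootODE) : Prop :=
  ∀ y : ℝ → ℝ, ContDiff ℝ ∞ y → ∀ x : ℝ, (x, y x) ∈ U →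
    deriv (E.lhs y) x = 0 → F.lhs y x = iteratedDeriv 2 (E.lhs y) x

/-- The left-hand side of the fourth-order equation is a total derivative: it is the derivative of
`G(x, y, y', y'', y''')` for a `C¹` function `G` on the space of 3-jets over `U`. -/
def IsTotalDerivative (U : Set (ℝ × ℝ)) (F : QuadODE) : Prop :=
  ∃ G : (ℝ × ℝ) × ℝ × ℝ × ℝ → ℝ,
    ContDiffOn ℝ 1 G {j | j.1 ∈ U} ∧
    ∀ y : ℝ → ℝ, ContDiff ℝ ∞ y → ∀ x : ℝ, (x, y x) ∈ U →
      F.lhs y x =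
        deriv (fun t => G ((t, y t), deriv y t, iteratedDeriv 2 y t, iteratedDeriv 3 y t)) x

/-- The algebraic identification of `c`, `g`, `h`. The last equation is
`h = (R₂ - Q₀^2 + Q₁ₓ - (5/2) Q₀ᵧ) / Q₁` wherever `Q₁ ≠ 0`. -/
def Identification (U : Set (ℝ × ℝ)) (F : QuadODE) (E : RootODE) : Prop :=
  ∀ z ∈ U, E.c z = F.Q1 z / 6 ∧ E.g z = F.Q0 z / 2 ∧
    F.Q1 z * E.h z = F.R2 z - F.Q0 z ^ 2 + dx F.Q1 z - 5 * dy F.Q0 z / 2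

/-- `d = ∫ (R₀ - h^2 + 2 hₓ) dy + k(x)`, on every vertical segment contained in `U`. -/
def IntegralFormula (U : Set (ℝ × ℝ)) (F : QuadODE) (E : RootODE) : Prop :=
  ∀ x y₁ y₂ : ℝ, (∀ t ∈ Set.uIcc y₁ y₂, (x, t) ∈ U) →
    E.d (x, y₂) =
      (∫ t in y₁..y₂, (F.R0 (x, t) - E.h (x, t) ^ 2 + 2 * dx E.h (x, t))) + E.d (x, y₁)

/-- The constraints on the remaining coefficients. -/
def Constraints (U : Set (ℝ × ℝ)) (F : QuadODE) (E : RootODE) : Prop :=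
  ∀ z ∈ U,
    F.R4 z = F.Q1 z ^ 2 / 4 ∧
    F.R3 z = F.Q1 z * F.Q0 z + 7 * dy F.Q1 z / 6 ∧
    F.R1 z = 2 * F.Q0 z * E.h z + 3 * dy E.h z - 2 * dx F.Q0 z ∧
    F.S6 z = F.Q1 z * dy F.Q1 z / 12 ∧
    F.S5 z = -(F.Q1 z * dx F.Q1 z) / 12 + F.Q0 z * dy F.Q1 z / 6 + F.Q1 z * dy F.Q0 z / 4
      + dy (dy F.Q1) z / 6 ∧
    F.S4 z = -(F.Q0 z * dx F.Q1 z) / 6 + E.h z * dy F.Q1 z / 6 - F.Q1 z * dx F.Q0 z / 4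
      + F.Q0 z * dy F.Q0 z / 2 + F.Q1 z * dy E.h z / 2 - dy (dx F.Q1) z / 3
      + dy (dy F.Q0) z / 2 ∧
    F.S3 z = F.Q1 z * (F.R0 z - E.h z ^ 2 + dx E.h z) / 2 - E.h z * dx F.Q1 z / 6
      - F.Q0 z * dx F.Q0 z / 2 + E.h z * dy F.Q0 z / 2 + F.Q0 z * dy E.h z
      + dx (dx F.Q1) z / 6 - dy (dx F.Q0) z + dy (dy E.h) z ∧
    F.S2 z = -(F.Q1 z * dx E.d z) / 2 + F.Q0 z * (F.R0 z - E.h z ^ 2 + dx E.h z)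
      - E.h z * dy E.h z - E.h z * dx F.Q0 z / 2 + dy F.R0 z + dx (dx F.Q0) z / 2 ∧
    F.S1 z = E.h z * (F.R0 z - E.h z ^ 2 + 5 * dx E.h z) - 2 * dx F.R0 z - F.Q0 z * dx E.d z
      - 3 * dx (dx E.h) z ∧
    F.S0 z = dx (dx E.d) z - E.h z * dx E.d z

/-- The Lie–Tresse linearizability criteria for the root equation. -/
def LieTresse (U : Set (ℝ × ℝ)) (E : RootODE) : Prop :=
  ∀ z ∈ U,
    3 * dx (fun w => E.c w * E.h w) z + 3 * E.d z * dy E.c z + 6 * E.c z * dy E.d z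
      - 2 * E.g z * dx E.g z - E.g z * dy E.h z
      - 3 * dx (dx E.c) z - 2 * dy (dx E.g) z - dy (dy E.h) z = 0 ∧
    3 * dy (fun w => E.d w * E.g w) z + 3 * E.c z * dx E.d z + 6 * E.d z * dx E.c z
      - 2 * E.h z * dy E.h z - E.h z * dx E.g z
      - 3 * dy (dy E.d) z - 2 * dy (dx E.h) z - dx (dx E.g) z = 0

/-- The second derivative `d²Y/dX²` of the image of the curve `x ↦ (x, y x)` under the change of
variables `(x, y) ↦ (X, Y)`; it is meaningful where `dX/dx ≠ 0`. -/
def transformedSecondDeriv (X Y : ℝ × ℝ → ℝ) (y : ℝ → ℝ) (x : ℝ) : ℝ :=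
  deriv (fun t => deriv (fun s => Y (s, y s)) t / deriv (fun s => X (s, y s)) t) x
    / deriv (fun s => X (s, y s)) x

/-- The root equation is linearizable on `U`: near every point a smooth invertible point
transformation `(x, y) ↦ (X, Y)` takes it to the linear equation `d²Y/dX² = 0`. -/
def RootODE.Linearizable (U : Set (ℝ × ℝ)) (E : RootODE) : Prop :=
  ∀ z₀ ∈ U, ∃ (V : Set (ℝ × ℝ)) (X Y : ℝ × ℝ → ℝ),
    IsOpen V ∧ z₀ ∈ V ∧ V ⊆ U ∧
    ContDiffOn ℝ ∞ X V ∧ ContDiffOn ℝ ∞ Y V ∧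
    Set.InjOn (fun z => (X z, Y z)) V ∧
    (∀ z ∈ V, dx X z * dy Y z - dy X z * dx Y z ≠ 0) ∧
    ∀ y : ℝ → ℝ, ContDiff ℝ ∞ y → ∀ x : ℝ, (x, y x) ∈ V →
      deriv (fun s => X (s, y s)) x ≠ 0 →
      (E.lhs y x = 0 ↔ transformedSecondDeriv X Y y x = 0)

/-- The fourth-order equation is conditionally linearizable, subject to the root equation:
every solution of the root equation solves it, and the root equation is linearizable. -/
def ConditionallyLinearizable (U : Set (ℝ × ℝ)) (F : QuadODE) (E : RootODE) : Prop :=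
  (∀ (I : Set ℝ) (y : ℝ → ℝ), E.IsSolution U I y → F.IsSolution U I y) ∧ E.Linearizable U

/-- Vanishing on `V` of the curvature of the connection with Christoffel symbols
`Γ¹₁₁ = -a, Γ¹₁₂ = -b, Γ¹₂₂ = -c, Γ²₁₁ = -d, Γ²₁₂ = -e, Γ²₂₂ = -f`. -/
def Flat (V : Set (ℝ × ℝ)) (a b c d e f : ℝ × ℝ → ℝ) : Prop :=
  ∀ z ∈ V,
    dy a z - dx b z + b z * e z - c z * d z = 0 ∧
    dy b z - dx c z + (a z * c z - b z ^ 2) + (b z * f z - c z * e z) = 0 ∧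
    dy d z - dx e z - (a z * e z - b z * d z) - (d z * f z - e z ^ 2) = 0 ∧
    dx (fun w => b w + f w) z = dy (fun w => a w + e w) z

/-- On `V`, the same Christoffel symbols are those of the nondegenerate metric
`p dx² + 2 q dx dy + r dy²`. -/
def MetricCompatible (V : Set (ℝ × ℝ)) (a b c d e f p q r : ℝ × ℝ → ℝ) : Prop :=
  ∀ z ∈ V,
    p z * r z - q z ^ 2 ≠ 0 ∧
    dx p z = -2 * (a z * p z + d z * q z) ∧
    dx q z = -(b z * p z) - (a z + e z) * q z - d z * r z ∧
    dx r z = -2 * (b z * q z + e z * r z) ∧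
    dy p z = -2 * (b z * p z + e z * q z) ∧
    dy q z = -(c z * p z) - (b z + f z) * q z - e z * r z ∧
    dy r z = -2 * (c z * q z + f z * r z)

/-- Near every point of `U` the coefficients `c, d` of the root equation can be completed by
`a, b, e, f` with `h = a - 2 e`, `g = f - 2 b` to the Christoffel symbols of a flat metric. -/
def MetricConsistent (U : Set (ℝ × ℝ)) (E : RootODE) : Prop :=
  ∀ z₀ ∈ U, ∃ (V : Set (ℝ × ℝ)) (a b e f p q r : ℝ × ℝ → ℝ),
    IsOpen V ∧ z₀ ∈ V ∧ V ⊆ U ∧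
    (ContDiffOn ℝ ∞ a V ∧ ContDiffOn ℝ ∞ b V ∧ ContDiffOn ℝ ∞ e V ∧ ContDiffOn ℝ ∞ f V) ∧
    (ContDiffOn ℝ ∞ p V ∧ ContDiffOn ℝ ∞ q V ∧ ContDiffOn ℝ ∞ r V) ∧
    (∀ z ∈ V, E.h z = a z - 2 * e z ∧ E.g z = f z - 2 * b z) ∧
    Flat V a b E.c E.d e f ∧
    MetricCompatible V a b E.c E.d e f p q r

end CondLin

end

/-!
Eliminating `y'''` from the twice differentiated root equation leaves an explicit fourth-order
equation, quadratic in `y''`. Since the jets `(x, y, y', y'')` are free, two such equations agree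
exactly when all coefficients of the polynomials in `y'` and `y''` agree, and this comparison is
the first part; `R₀` determines `d_y`, whence the integral formula.

For the second part, write the root equation as the equation of unparametrized geodesics of an
affine connection. The connections with these geodesics that come from a scale `u` are flat when
`u` solves a linear system prescribing all its second derivatives, and the Lie–Tresse criteria are
the integrability conditions of this system. Three solutions `u, v, w` with independent 1-jets give
affine coordinates `X = v / u`, `Y = w / u`. Geodesics become straight lines in these coordinates,
which is the linearization, and `dX² + dY²` is the required flat metric.

For the third part, if the left-hand side is the total derivative of `G`, then comparing the
coefficients of `y''''` gives `G = y''' + H(x, y, y', y'')`, and comparing those of `y'''` shows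
that `H` does not depend on `y''`. A total derivative of `H(x, y, y')` is affine in `y''`.
-/

noncomputable section

namespace CondLin

open Metric Filter Topology

/-! ### Linear total differential equations in two variables -/

section TotalDifferential

variable {E : Type*} [NormedAddCommGroup E] [NormedSpace ℝ E]

theorem norm_le_of_norm_deriv_le {f f' : ℝ → E} {t₀ δ K ε : ℝ} (hδ : 0 ≤ δ) (hε : 0 ≤ ε)
    (hK : 0 ≤ K) (hKδ : K * δ ≤ 1 / 2)
    (hf : ∀ t ∈ closedBall t₀ δ, HasDerivWithinAt f (f' t) (closedBall t₀ δ) t)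
    (bound : ∀ t ∈ closedBall t₀ δ, ‖f' t‖ ≤ K * ‖f t‖ + ε) :
    ∀ t ∈ closedBall t₀ δ, ‖f t‖ ≤ 2 * ‖f t₀‖ + 2 * (ε * δ) := by
  have ht₀ : t₀ ∈ closedBall t₀ δ := mem_closedBall_self hδ
  obtain ⟨s, hs, hmax⟩ := (isCompact_closedBall t₀ δ).exists_isMaxOn ⟨t₀, ht₀⟩
    (fun t ht => (hf t ht).continuousWithinAt.norm : ContinuousOn (fun t => ‖f t‖) _)
  have hf' : ∀ t ∈ closedBall t₀ δ, ‖f' t‖ ≤ K * ‖f s‖ + ε := fun t ht =>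
    (bound t ht).trans (by gcongr; exact hmax ht)
  have hfs : ‖f s‖ ≤ ‖f t₀‖ + (K * ‖f s‖ + ε) * δ :=
    calc ‖f s‖ ≤ ‖f t₀‖ + ‖f s - f t₀‖ := norm_le_norm_add_norm_sub' _ _
      _ ≤ ‖f t₀‖ + (K * ‖f s‖ + ε) * ‖s - t₀‖ := by
        gcongr
        exact (convex_closedBall t₀ δ).norm_image_sub_le_of_norm_hasDerivWithin_le hf hf' ht₀ hs
      _ ≤ ‖f t₀‖ + (K * ‖f s‖ + ε) * δ := by
        gcongr
        exact mem_closedBall_iff_norm.1 hs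
  have habsorb : K * δ * ‖f s‖ ≤ 1 / 2 * ‖f s‖ := by gcongr
  intro t ht
  have hts : ‖f t‖ ≤ ‖f s‖ := hmax ht
  linarith

theorem exists_linear_ode_solution [CompleteSpace E] {C : ℝ → E →L[ℝ] E} {t₀ δ M : ℝ} (hδ : 0 ≤ δ)
    (hM : 0 ≤ M) (hMδ : M * δ ≤ 1 / 2) (hC : ContinuousOn C (closedBall t₀ δ))
    (hCM : ∀ t ∈ closedBall t₀ δ, ‖C t‖ ≤ M) (w : E) :
    ∃ α : ℝ → E, α t₀ = w ∧ ∀ t ∈ closedBall t₀ δ,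
      HasDerivWithinAt α (C t (α t)) (closedBall t₀ δ) t ∧ ‖α t‖ ≤ 2 * ‖w‖ := by
  suffices ∃ α : ℝ → E, α t₀ = w ∧ ∀ t ∈ closedBall t₀ δ,
      HasDerivWithinAt α (C t (α t)) (closedBall t₀ δ) t by
    obtain ⟨α, hα₀, hα⟩ := this
    refine ⟨α, hα₀, fun t ht => ⟨hα t ht, ?_⟩⟩
    simpa [hα₀] using norm_le_of_norm_deriv_le hδ le_rfl hM hMδ hα
      (fun t ht => by simpa using (C t).le_of_opNorm_le (hCM t ht) _) t ht
  rw [Real.closedBall_eq_Icc] at *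
  lift M to NNReal using hM
  have ht₀ : t₀ ∈ Set.Icc (t₀ - δ) (t₀ + δ) := ⟨by linarith, by linarith⟩
  have hPL : IsPicardLindelof (fun t x => C t x) (⟨t₀, ht₀⟩ : Set.Icc (t₀ - δ) (t₀ + δ)) w
      ‖w‖₊ 0 (2 * M * ‖w‖₊) M := by
    refine ⟨fun t ht => (((C t).lipschitz).weaken (hCM t ht)).lipschitzOnWith,
      fun x _ => hC.clm_apply continuousOn_const, fun t ht x hx => ?_, ?_⟩
    · have hx' : ‖x‖ ≤ 2 * ‖w‖ := by
        have hxw : ‖x - w‖ ≤ ‖w‖ := by simpa [dist_eq_norm] using hx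
        linarith [norm_le_norm_add_norm_sub' x w]
      calc ‖C t x‖ ≤ M * (2 * ‖w‖) := (C t).le_of_opNorm_le_of_le (hCM t ht) hx'
        _ = _ := by push_cast; ring
    · simp only [add_sub_cancel_left, sub_sub_cancel, max_self]
      push_cast
      nlinarith [norm_nonneg w]
  exact hPL.exists_eq_forall_mem_Icc_hasDerivWithinAt₀

theorem norm_sub_sub_smul_le_of_lipschitz_deriv {f f' : ℝ → E} {s : Set ℝ} (hs : Convex ℝ s)
    {M : ℝ} (hM : 0 ≤ M) (hf : ∀ t ∈ s, HasDerivWithinAt f (f' t) s t)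
    (hf' : ∀ t ∈ s, ∀ t' ∈ s, ‖f' t' - f' t‖ ≤ M * ‖t' - t‖) {x x' : ℝ}
    (hx : x ∈ s) (hx' : x' ∈ s) :
    ‖f x' - f x - (x' - x) • f' x‖ ≤ M * ‖x' - x‖ ^ 2 := by
  have hsub : Set.uIcc x x' ⊆ s := hs.ordConnected.uIcc_subset hx hx'
  have h := (convex_uIcc x x').norm_image_sub_le_of_norm_hasDerivWithin_le
    (f := fun t => f t - t • f' x) (f' := fun t => f' t - (1 : ℝ) • f' x) (C := M * ‖x' - x‖)
    (fun t ht => ((hf t (hsub ht)).mono hsub).sub ((hasDerivWithinAt_id t _).smul_const _))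
    (fun t ht => by
      have htx : ‖t - x‖ ≤ ‖x' - x‖ := Set.abs_sub_left_of_mem_uIcc ht
      rw [one_smul]
      exact (hf' x hx t (hsub ht)).trans (by gcongr))
    Set.left_mem_uIcc Set.right_mem_uIcc
  calc ‖f x' - f x - (x' - x) • f' x‖ = ‖f x' - x' • f' x - (f x - x • f' x)‖ := by
        congr 1; module
    _ ≤ M * ‖x' - x‖ * ‖x' - x‖ := h
    _ = M * ‖x' - x‖ ^ 2 := by ring

theorem hasDerivWithinAt_of_norm_sub_sub_smul_le {F : Type*} [NormedAddCommGroup F]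
    [NormedSpace ℝ F] {f : ℝ → E} {m : ℝ → F} {f' : E} {m' : F} {s : Set ℝ} {x c K : ℝ}
    (hm : HasDerivWithinAt m m' s x)
    (h : ∀ x' ∈ s, ‖f x' - f x - (x' - x) • f'‖ ≤
      c * ‖m x' - m x - (x' - x) • m'‖ + K * ‖x' - x‖ ^ 2) :
    HasDerivWithinAt f f' s x := by
  rw [hasDerivWithinAt_iff_isLittleO] at hm ⊢
  have hsq : (fun x' => ‖x' - x‖ ^ 2) =o[𝓝[s] x] fun x' => x' - x :=
    ((Asymptotics.isLittleO_pow_sub_sub x one_lt_two).mono nhdsWithin_le_nhds).congr_left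
      fun x' => by simp
  refine Asymptotics.IsBigO.trans_isLittleO (.of_bound' ?_)
    ((hm.norm_left.const_mul_left c).add (hsq.const_mul_left K))
  filter_upwards [self_mem_nhdsWithin] with x' hx'
  exact (h x' hx').trans (le_abs_self _)

-- The error `w' - w - η A w` solves the equation for `w'` up to a remainder quadratic in `η`.
theorem norm_sub_sub_smul_le_of_linear_ode {A A' C C' D : ℝ → E →L[ℝ] E} {w w' : ℝ → E}
    {t₀ δ M N η : ℝ} (hδ : 0 ≤ δ) (hM : 0 ≤ M) (hN : 0 ≤ N) (hMδ : M * δ ≤ 1 / 2)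
    (hw : ∀ t ∈ closedBall t₀ δ, HasDerivWithinAt w (C t (w t)) (closedBall t₀ δ) t)
    (hw' : ∀ t ∈ closedBall t₀ δ, HasDerivWithinAt w' (C' t (w' t)) (closedBall t₀ δ) t)
    (hA : ∀ t ∈ closedBall t₀ δ, HasDerivWithinAt A (A' t) (closedBall t₀ δ) t)
    (hcomm : ∀ t ∈ closedBall t₀ δ, ∀ v, A' t v + A t (C t v) = D t v + C t (A t v))
    (hAM : ∀ t ∈ closedBall t₀ δ, ‖A t‖ ≤ M) (hCM : ∀ t ∈ closedBall t₀ δ, ‖C' t‖ ≤ M)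
    (hCC : ∀ t ∈ closedBall t₀ δ, ‖C' t - C t‖ ≤ M * ‖η‖)
    (hCD : ∀ t ∈ closedBall t₀ δ, ‖C' t - C t - η • D t‖ ≤ M * ‖η‖ ^ 2)
    (hwN : ∀ t ∈ closedBall t₀ δ, ‖w t‖ ≤ N) :
    ∀ t ∈ closedBall t₀ δ, ‖w' t - w t - η • A t (w t)‖ ≤
      2 * ‖w' t₀ - w t₀ - η • A t₀ (w t₀)‖ + 2 * ((M * N + M * (M * N)) * ‖η‖ ^ 2 * δ) := by
  refine norm_le_of_norm_deriv_le hδ (by positivity) hM hMδ (fun t ht =>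
    ((hw' t ht).sub (hw t ht)).sub (((hA t ht).clm_apply (hw t ht)).const_smul η)) fun t ht => ?_
  have hsplit : C' t (w' t) - C t (w t) - η • (A' t (w t) + A t (C t (w t))) =
      C' t (w' t - w t - η • A t (w t)) + (C' t - C t - η • D t) (w t) +
        η • (C' t - C t) (A t (w t)) := by
    rw [hcomm t ht]
    simp only [map_sub, map_smul, sub_apply, smul_apply]
    module
  have hAw : ‖A t (w t)‖ ≤ M * N := (A t).le_of_opNorm_le_of_le (hAM t ht) (hwN t ht)
  calc _ ≤ ‖C' t (w' t - w t - η • A t (w t))‖ + ‖(C' t - C t - η • D t) (w t)‖ +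
        ‖η • (C' t - C t) (A t (w t))‖ := by rw [hsplit]; exact norm_add₃_le
    _ ≤ M * ‖w' t - w t - η • A t (w t)‖ + M * ‖η‖ ^ 2 * N + ‖η‖ * (M * ‖η‖ * (M * N)) := by
        rw [norm_smul]
        gcongr
        · exact (C' t).le_of_opNorm_le (hCM t ht) _
        · exact ContinuousLinearMap.le_of_opNorm_le_of_le _ (hCD t ht) (hwN t ht)
        · exact ContinuousLinearMap.le_of_opNorm_le_of_le _ (hCC t ht) hAw
    _ = _ := by ring

section Partials

variable {F : Type*} [NormedAddCommGroup F] [NormedSpace ℝ F] {f : ℝ × ℝ → F} {z : ℝ × ℝ}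

theorem hasDerivAt_fst_of_differentiableAt (hf : DifferentiableAt ℝ f z) :
    HasDerivAt (fun t => f (t, z.2)) (fderiv ℝ f z (1, 0)) z.1 :=
  HasFDerivAt.comp_hasDerivAt (f := fun t : ℝ => (t, z.2)) z.1 hf.hasFDerivAt
    ((hasDerivAt_id _).prodMk (hasDerivAt_const _ _))

theorem hasDerivAt_snd_of_differentiableAt (hf : DifferentiableAt ℝ f z) :
    HasDerivAt (fun t => f (z.1, t)) (fderiv ℝ f z (0, 1)) z.2 :=
  HasFDerivAt.comp_hasDerivAt (f := fun t : ℝ => (z.1, t)) z.2 hf.hasFDerivAt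
    ((hasDerivAt_const _ _).prodMk (hasDerivAt_id _))

theorem norm_sub_le_of_norm_fderiv_fst_le {x₀ y δ M : ℝ}
    (hf : ∀ x ∈ closedBall x₀ δ, DifferentiableAt ℝ f (x, y))
    (hM : ∀ x ∈ closedBall x₀ δ, ‖fderiv ℝ f (x, y) (1, 0)‖ ≤ M) :
    ∀ x ∈ closedBall x₀ δ, ∀ x' ∈ closedBall x₀ δ, ‖f (x', y) - f (x, y)‖ ≤ M * ‖x' - x‖ :=
  fun _ hx _ hx' => (convex_closedBall x₀ δ).norm_image_sub_le_of_norm_hasDerivWithin_le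
    (f := fun t => f (t, y))
    (fun t ht => (hasDerivAt_fst_of_differentiableAt (hf t ht)).hasDerivWithinAt) hM hx hx'

end Partials

/-- The local solvability data for `W_x = A W`, `W_y = B W` on the closed square of radius `δ`
around `(x₀, y₀)`: differentiability of the coefficients, the integrability condition
`A_y + A B = B_x + B A`, and bounds by an `M` for which the square is small. -/
structure IntegrableOnSquare (A B : ℝ × ℝ → E →L[ℝ] E) (x₀ y₀ δ M : ℝ) : Prop where
  radius_nonneg : 0 ≤ δ
  bound_nonneg : 0 ≤ M
  bound_mul_radius_le : M * δ ≤ 1 / 2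
  differentiableAt_left : ∀ x ∈ closedBall x₀ δ, ∀ y ∈ closedBall y₀ δ, DifferentiableAt ℝ A (x, y)
  differentiableAt_right : ∀ x ∈ closedBall x₀ δ, ∀ y ∈ closedBall y₀ δ, DifferentiableAt ℝ B (x, y)
  differentiableAt_right_fst : ∀ x ∈ closedBall x₀ δ, ∀ y ∈ closedBall y₀ δ,
    DifferentiableAt ℝ (fun z => fderiv ℝ B z (1, 0)) (x, y)
  norm_left_le : ∀ x ∈ closedBall x₀ δ, ∀ y ∈ closedBall y₀ δ, ‖A (x, y)‖ ≤ M
  norm_right_le : ∀ x ∈ closedBall x₀ δ, ∀ y ∈ closedBall y₀ δ, ‖B (x, y)‖ ≤ M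
  norm_right_fst_le : ∀ x ∈ closedBall x₀ δ, ∀ y ∈ closedBall y₀ δ,
    ‖fderiv ℝ B (x, y) (1, 0)‖ ≤ M
  norm_right_fst_fst_le : ∀ x ∈ closedBall x₀ δ, ∀ y ∈ closedBall y₀ δ,
    ‖fderiv ℝ (fun z => fderiv ℝ B z (1, 0)) (x, y) (1, 0)‖ ≤ M
  integrable : ∀ x ∈ closedBall x₀ δ, ∀ y ∈ closedBall y₀ δ, ∀ w,
    fderiv ℝ A (x, y) (0, 1) w + A (x, y) (B (x, y) w) =
      fderiv ℝ B (x, y) (1, 0) w + B (x, y) (A (x, y) w)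

variable {A B : ℝ × ℝ → E →L[ℝ] E} {x₀ y₀ δ M : ℝ}

namespace IntegrableOnSquare

theorem hasDerivWithinAt_fst (H : IntegrableOnSquare A B x₀ y₀ δ M) {m : ℝ → E} {W : ℝ → ℝ → E}
    {N : ℝ} (hN : 0 ≤ N) (hW₀ : ∀ x ∈ closedBall x₀ δ, W x y₀ = m x)
    (hm : ∀ x ∈ closedBall x₀ δ, HasDerivWithinAt m (A (x, y₀) (m x)) (closedBall x₀ δ) x)
    (hW : ∀ x ∈ closedBall x₀ δ, ∀ y ∈ closedBall y₀ δ,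
      HasDerivWithinAt (W x) (B (x, y) (W x y)) (closedBall y₀ δ) y ∧ ‖W x y‖ ≤ N) :
    ∀ x ∈ closedBall x₀ δ, ∀ y ∈ closedBall y₀ δ,
      HasDerivWithinAt (fun t => W t y) (A (x, y) (W x y)) (closedBall x₀ δ) x := by
  intro x hx y hy
  refine hasDerivWithinAt_of_norm_sub_sub_smul_le (c := 2)
    (K := 2 * ((M * N + M * (M * N)) * δ)) (hm x hx) fun x' hx' => ?_
  have hlip : ∀ t ∈ closedBall y₀ δ, ‖B (x', t) - B (x, t)‖ ≤ M * ‖x' - x‖ := fun t ht =>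
    norm_sub_le_of_norm_fderiv_fst_le (fun s hs => H.differentiableAt_right s hs t ht)
      (fun s hs => H.norm_right_fst_le s hs t ht) x hx x' hx'
  have htaylor : ∀ t ∈ closedBall y₀ δ,
      ‖B (x', t) - B (x, t) - (x' - x) • fderiv ℝ B (x, t) (1, 0)‖ ≤ M * ‖x' - x‖ ^ 2 :=
    fun t ht => norm_sub_sub_smul_le_of_lipschitz_deriv (f := fun s => B (s, t))
      (f' := fun s => fderiv ℝ B (s, t) (1, 0)) (convex_closedBall x₀ δ) H.bound_nonneg
      (fun s hs => (hasDerivAt_fst_of_differentiableAt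
        (H.differentiableAt_right s hs t ht)).hasDerivWithinAt)
      (norm_sub_le_of_norm_fderiv_fst_le (fun s hs => H.differentiableAt_right_fst s hs t ht)
        fun s hs => H.norm_right_fst_fst_le s hs t ht) hx hx'
  have h := norm_sub_sub_smul_le_of_linear_ode (A := fun t => A (x, t)) (C := fun t => B (x, t))
    (C' := fun t => B (x', t)) H.radius_nonneg H.bound_nonneg hN H.bound_mul_radius_le
    (fun t ht => (hW x hx t ht).1) (fun t ht => (hW x' hx' t ht).1)
    (fun t ht => (hasDerivAt_snd_of_differentiableAt
      (H.differentiableAt_left x hx t ht)).hasDerivWithinAt)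
    (H.integrable x hx) (H.norm_left_le x hx) (H.norm_right_le x' hx') hlip htaylor
    (fun t ht => (hW x hx t ht).2) y hy
  rw [hW₀ x hx, hW₀ x' hx'] at h
  exact h.trans_eq (by ring)

theorem exists_solution [CompleteSpace E] (H : IntegrableOnSquare A B x₀ y₀ δ M) (w₀ : E) :
    ∃ W : ℝ → ℝ → E, W x₀ y₀ = w₀ ∧ ∀ x ∈ closedBall x₀ δ, ∀ y ∈ closedBall y₀ δ,
      HasDerivWithinAt (fun t => W t y) (A (x, y) (W x y)) (closedBall x₀ δ) x ∧
      HasDerivWithinAt (W x) (B (x, y) (W x y)) (closedBall y₀ δ) y ∧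
      ‖W x y‖ ≤ 4 * ‖w₀‖ := by
  have hx₀ : x₀ ∈ closedBall x₀ δ := mem_closedBall_self H.radius_nonneg
  have hy₀ : y₀ ∈ closedBall y₀ δ := mem_closedBall_self H.radius_nonneg
  obtain ⟨m, hm₀, hm⟩ := exists_linear_ode_solution (C := fun x => A (x, y₀)) H.radius_nonneg
    H.bound_nonneg H.bound_mul_radius_le (fun x hx => (hasDerivAt_fst_of_differentiableAt
      (H.differentiableAt_left x hx y₀ hy₀)).continuousAt.continuousWithinAt)
    (fun x hx => H.norm_left_le x hx y₀ hy₀) w₀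
  choose! W hW₀ hW using fun x (hx : x ∈ closedBall x₀ δ) =>
    exists_linear_ode_solution (C := fun y => B (x, y)) H.radius_nonneg H.bound_nonneg
      H.bound_mul_radius_le (fun y hy => (hasDerivAt_snd_of_differentiableAt
        (H.differentiableAt_right x hx y hy)).continuousAt.continuousWithinAt)
      (H.norm_right_le x hx) (m x)
  have hWb : ∀ x ∈ closedBall x₀ δ, ∀ y ∈ closedBall y₀ δ, ‖W x y‖ ≤ 4 * ‖w₀‖ :=
    fun x hx y hy => by linarith [(hW x hx y hy).2, (hm x hx).2]
  have hWy := fun x hx y hy => And.intro (hW x hx y hy).1 (hWb x hx y hy)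
  exact ⟨W, by rw [hW₀ x₀ hx₀, hm₀], fun x hx y hy =>
    ⟨H.hasDerivWithinAt_fst (by positivity) hW₀ (fun x hx => (hm x hx).1) hWy x hx y hy,
      hWy x hx y hy⟩⟩

end IntegrableOnSquare

theorem exists_integrableOnSquare {U : Set (ℝ × ℝ)} (hU : IsOpen U) (hA : ContDiffOn ℝ 1 A U)
    (hB : ContDiffOn ℝ 2 B U)
    (hint : ∀ z ∈ U, ∀ w, fderiv ℝ A z (0, 1) w + A z (B z w) =
      fderiv ℝ B z (1, 0) w + B z (A z w)) (hU₀ : (x₀, y₀) ∈ U) :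
    ∃ δ > 0, closedBall x₀ δ ×ˢ closedBall y₀ δ ⊆ U ∧ ∃ M, IntegrableOnSquare A B x₀ y₀ δ M := by
  obtain ⟨ρ, hρ, hρU⟩ := nhds_basis_closedBall.mem_iff.1 (hU.mem_nhds hU₀)
  have hBx : ContDiffOn ℝ 1 (fun z => fderiv ℝ B z (1, 0)) U :=
    (hB.fderiv_of_isOpen hU (by norm_num)).clm_apply contDiffOn_const
  have hBxx : ContinuousOn (fun z => fderiv ℝ (fun z => fderiv ℝ B z (1, 0)) z (1, 0)) U :=
    (hBx.continuousOn_fderiv_of_isOpen hU le_rfl).clm_apply continuousOn_const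
  have hbounded : ∀ {F : Type _} [NormedAddCommGroup F] {f : ℝ × ℝ → F}, ContinuousOn f U →
      ∃ C, ∀ z ∈ closedBall (x₀, y₀) ρ, ‖f z‖ ≤ C := fun hf =>
    (isCompact_closedBall _ ρ).exists_bound_of_continuousOn (hf.mono hρU)
  obtain ⟨M, hM₀, hM⟩ : ∃ M, 0 < M ∧ ∀ z ∈ closedBall (x₀, y₀) ρ, ‖A z‖ ≤ M ∧ ‖B z‖ ≤ M ∧
      ‖fderiv ℝ B z (1, 0)‖ ≤ M ∧
      ‖fderiv ℝ (fun z => fderiv ℝ B z (1, 0)) z (1, 0)‖ ≤ M := by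
    obtain ⟨C, hC⟩ := hbounded
      (((hA.continuousOn.prodMk hB.continuousOn).prodMk hBx.continuousOn).prodMk hBxx)
    refine ⟨max C 1, by positivity, fun z hz => ?_⟩
    simpa only [Prod.norm_def, max_le_iff, and_assoc] using (hC z hz).trans (le_max_left C 1)
  obtain ⟨δ, hδ, hδρ, hMδ⟩ : ∃ δ : ℝ, 0 < δ ∧ δ ≤ ρ ∧ M * δ ≤ 1 / 2 :=
    ⟨min ρ (1 / (2 * M)), by positivity, min_le_left _ _,
      calc M * min ρ (1 / (2 * M)) ≤ M * (1 / (2 * M)) := by gcongr; exact min_le_right _ _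
        _ = 1 / 2 := by field_simp⟩
  have hball : ∀ x ∈ closedBall x₀ δ, ∀ y ∈ closedBall y₀ δ, (x, y) ∈ closedBall (x₀, y₀) ρ :=
    fun x hx y hy => closedBall_subset_closedBall hδρ (closedBall_prod_same x₀ y₀ δ ▸ ⟨hx, hy⟩)
  have hdiff : ∀ {f : ℝ × ℝ → E →L[ℝ] E} {n : ℕ∞ω}, ContDiffOn ℝ n f U → n ≠ 0 →
      ∀ x ∈ closedBall x₀ δ, ∀ y ∈ closedBall y₀ δ, DifferentiableAt ℝ f (x, y) :=
    fun hf hn x hx y hy =>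
      (hf.differentiableOn hn).differentiableAt (hU.mem_nhds (hρU (hball x hx y hy)))
  exact ⟨δ, hδ, fun z hz => hρU (hball z.1 hz.1 z.2 hz.2), M,
    { radius_nonneg := hδ.le
      bound_nonneg := hM₀.le
      bound_mul_radius_le := hMδ
      differentiableAt_left := hdiff hA one_ne_zero
      differentiableAt_right := hdiff hB two_ne_zero
      differentiableAt_right_fst := hdiff hBx one_ne_zero
      norm_left_le := fun x hx y hy => (hM _ (hball x hx y hy)).1
      norm_right_le := fun x hx y hy => (hM _ (hball x hx y hy)).2.1
      norm_right_fst_le := fun x hx y hy => (hM _ (hball x hx y hy)).2.2.1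
      norm_right_fst_fst_le := fun x hx y hy => (hM _ (hball x hx y hy)).2.2.2
      integrable := fun x hx y hy => hint _ (hρU (hball x hx y hy)) }⟩

/-- `W` solves the linear total differential equation `dW = A W dx + B W dy` on `V`. -/
def IsTotalDifferentialSolution (A B : ℝ × ℝ → E →L[ℝ] E) (V : Set (ℝ × ℝ)) (W : ℝ × ℝ → E) :
    Prop :=
  ∀ z ∈ V, HasFDerivAt W ((ContinuousLinearMap.toSpanSingleton ℝ (A z (W z))).coprod
    (ContinuousLinearMap.toSpanSingleton ℝ (B z (W z)))) z

theorem IsTotalDifferentialSolution.contDiffOn {V : Set (ℝ × ℝ)} {W : ℝ × ℝ → E}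
    (hW : IsTotalDifferentialSolution A B V W) (hV : IsOpen V) (hA : ContDiffOn ℝ ∞ A V)
    (hB : ContDiffOn ℝ ∞ B V) : ContDiffOn ℝ ∞ W V := by
  rw [contDiffOn_infty]
  intro n
  induction n with
  | zero => exact contDiffOn_zero.2 fun z hz => (hW z hz).continuousAt.continuousWithinAt
  | succ n ih =>
    push_cast
    rw [contDiffOn_succ_iff_fderiv_of_isOpen hV]
    refine ⟨fun z hz => (hW z hz).differentiableAt.differentiableWithinAt, by simp, ?_⟩
    have hn : (n : ℕ∞ω) ≤ ∞ := by exact_mod_cast le_top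
    have hfderiv : ∀ z ∈ V, fderiv ℝ W z =
        (ContinuousLinearMap.fst ℝ ℝ ℝ).smulRight (A z (W z)) +
          (ContinuousLinearMap.snd ℝ ℝ ℝ).smulRight (B z (W z)) := fun z hz => by
      rw [(hW z hz).fderiv]
      ext <;> simp
    exact ((contDiffOn_const.smulRight ((hA.of_le hn).clm_apply ih)).add
      (contDiffOn_const.smulRight ((hB.of_le hn).clm_apply ih))).congr hfderiv

theorem IntegrableOnSquare.exists_isTotalDifferentialSolution [CompleteSpace E]
    (H : IntegrableOnSquare A B x₀ y₀ δ M) (w₀ : E) :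
    ∃ W : ℝ × ℝ → E, W (x₀, y₀) = w₀ ∧
      IsTotalDifferentialSolution A B (ball x₀ δ ×ˢ ball y₀ δ) W := by
  obtain ⟨W, hW₀, hW⟩ := H.exists_solution w₀
  have hVS : ∀ z ∈ ball x₀ δ ×ˢ ball y₀ δ, z.1 ∈ closedBall x₀ δ ∧ z.2 ∈ closedBall y₀ δ :=
    fun z hz => ⟨ball_subset_closedBall hz.1, ball_subset_closedBall hz.2⟩
  have hcont : ContinuousOn (fun z : ℝ × ℝ => W z.1 z.2) (closedBall x₀ δ ×ˢ closedBall y₀ δ) := by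
    have hMN : 0 ≤ M * (4 * ‖w₀‖) := mul_nonneg H.bound_nonneg (by positivity)
    refine continuousOn_prod_of_continuousOn_lipschitzOnWith _ ⟨M * (4 * ‖w₀‖), hMN⟩
      (fun x hx y hy => (hW x hx y hy).2.1.continuousWithinAt) fun y hy => ?_
    exact (convex_closedBall x₀ δ).lipschitzOnWith_of_nnnorm_hasDerivWithin_le
      (fun x hx => (hW x hx y hy).1) fun x hx => ContinuousLinearMap.le_of_opNorm_le_of_le _
        (H.norm_left_le x hx y hy) (hW x hx y hy).2.2
  refine ⟨fun z => W z.1 z.2, hW₀, fun z hz => ?_⟩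
  have hnear : ball x₀ δ ×ˢ ball y₀ δ ∈ 𝓝 z := (isOpen_ball.prod isOpen_ball).mem_nhds hz
  have hWz : ContinuousAt (fun z : ℝ × ℝ => W z.1 z.2) z :=
    hcont.continuousAt (mem_of_superset hnear hVS)
  have hcoeff : ∀ {C : ℝ × ℝ → E →L[ℝ] E}, DifferentiableAt ℝ C z → ContinuousAt
      (fun z : ℝ × ℝ => ContinuousLinearMap.toSpanSingleton ℝ (C z (W z.1 z.2))) z := fun hC =>
    (ContinuousLinearMap.toSpanSingletonCLE (𝕜 := ℝ) (E := E)).continuous.continuousAt.comp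
      (hC.continuousAt.clm_apply hWz)
  refine (hasStrictFDerivAt_uncurry_coprod (𝕜 := ℝ) (u := z) (f := W)
    (f₁ := fun x y => ContinuousLinearMap.toSpanSingleton ℝ (A (x, y) (W x y)))
    (f₂ := fun x y => ContinuousLinearMap.toSpanSingleton ℝ (B (x, y) (W x y))) ?_ ?_
    (hcoeff (H.differentiableAt_left _ (hVS z hz).1 _ (hVS z hz).2))
    (hcoeff (H.differentiableAt_right _ (hVS z hz).1 _ (hVS z hz).2))).hasFDerivAt
  · filter_upwards [hnear] with v hv
    exact ((hW v.1 (hVS v hv).1 v.2 (hVS v hv).2).1.hasDerivAt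
      (closedBall_mem_nhds_of_mem hv.1)).hasFDerivAt
  · filter_upwards [hnear] with v hv
    exact ((hW v.1 (hVS v hv).1 v.2 (hVS v hv).2).2.1.hasDerivAt
      (closedBall_mem_nhds_of_mem hv.2)).hasFDerivAt

theorem exists_forall_isTotalDifferentialSolution [CompleteSpace E] {U : Set (ℝ × ℝ)}
    (hU : IsOpen U) (hA : ContDiffOn ℝ ∞ A U) (hB : ContDiffOn ℝ ∞ B U)
    (hint : ∀ z ∈ U, ∀ w, fderiv ℝ A z (0, 1) w + A z (B z w) =
      fderiv ℝ B z (1, 0) w + B z (A z w)) {z₀ : ℝ × ℝ} (hz₀ : z₀ ∈ U) :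
    ∃ V ⊆ U, IsOpen V ∧ z₀ ∈ V ∧ ∀ w₀ : E, ∃ W : ℝ × ℝ → E, W z₀ = w₀ ∧
      ContDiffOn ℝ ∞ W V ∧ IsTotalDifferentialSolution A B V W := by
  obtain ⟨δ, hδ, hδU, M, H⟩ := exists_integrableOnSquare hU (contDiffOn_infty.1 hA 1)
    (contDiffOn_infty.1 hB 2) hint hz₀
  have hVU : ball z₀.1 δ ×ˢ ball z₀.2 δ ⊆ U :=
    (Set.prod_mono ball_subset_closedBall ball_subset_closedBall).trans hδU
  have hV : IsOpen (ball z₀.1 δ ×ˢ ball z₀.2 δ) := isOpen_ball.prod isOpen_ball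
  refine ⟨_, hVU, hV, ⟨mem_ball_self hδ, mem_ball_self hδ⟩, fun w₀ => ?_⟩
  obtain ⟨W, hW₀, hW⟩ := H.exists_isTotalDifferentialSolution w₀
  exact ⟨W, hW₀, hW.contDiffOn hV (hA.mono hVU) (hB.mono hVU), hW⟩

end TotalDifferential

/-! ### Partial derivatives -/

section PartialDerivatives

variable {f g : ℝ × ℝ → ℝ} {z : ℝ × ℝ}

theorem dx_eq_fderiv (hf : DifferentiableAt ℝ f z) : dx f z = fderiv ℝ f z (1, 0) :=
  (hasDerivAt_fst_of_differentiableAt hf).deriv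

theorem dy_eq_fderiv (hf : DifferentiableAt ℝ f z) : dy f z = fderiv ℝ f z (0, 1) :=
  (hasDerivAt_snd_of_differentiableAt hf).deriv

theorem fderiv_apply_eq_dx_add_dy (hf : DifferentiableAt ℝ f z) (v : ℝ × ℝ) :
    fderiv ℝ f z v = dx f z * v.1 + dy f z * v.2 := by
  have hv : v = v.1 • ((1, 0) : ℝ × ℝ) + v.2 • (0, 1) := by simp
  rw [dx_eq_fderiv hf, dy_eq_fderiv hf, hv, map_add, map_smul, map_smul]
  simp [mul_comm]

theorem hasDerivAt_dx (hf : DifferentiableAt ℝ f z) :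
    HasDerivAt (fun t => f (t, z.2)) (dx f z) z.1 :=
  (hasDerivAt_fst_of_differentiableAt hf).differentiableAt.hasDerivAt

theorem hasDerivAt_dy (hf : DifferentiableAt ℝ f z) :
    HasDerivAt (fun t => f (z.1, t)) (dy f z) z.2 :=
  (hasDerivAt_snd_of_differentiableAt hf).differentiableAt.hasDerivAt

theorem hasDerivAt_comp_graph {y : ℝ → ℝ} {x y' : ℝ} (hf : DifferentiableAt ℝ f (x, y x))
    (hy : HasDerivAt y y' x) :
    HasDerivAt (fun t => f (t, y t)) (dx f (x, y x) + dy f (x, y x) * y') x := by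
  refine (HasFDerivAt.comp_hasDerivAt (f := fun t => (t, y t)) x hf.hasFDerivAt
    ((hasDerivAt_id x).prodMk hy)).congr_deriv ?_
  rw [fderiv_apply_eq_dx_add_dy hf, mul_one]

theorem dx_congr (h : f =ᶠ[𝓝 z] g) : dx f z = dx g z :=
  (h.comp_tendsto (Continuous.prodMk_left z.2).continuousAt).deriv_eq

theorem dy_congr (h : f =ᶠ[𝓝 z] g) : dy f z = dy g z :=
  (h.comp_tendsto (Continuous.prodMk_right z.1).continuousAt).deriv_eq

theorem eqOn_dx {U : Set (ℝ × ℝ)} (hU : IsOpen U) (h : Set.EqOn f g U) :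
    Set.EqOn (dx f) (dx g) U :=
  fun _ hz => dx_congr (h.eventuallyEq_of_mem (hU.mem_nhds hz))

theorem eqOn_dy {U : Set (ℝ × ℝ)} (hU : IsOpen U) (h : Set.EqOn f g U) :
    Set.EqOn (dy f) (dy g) U :=
  fun _ hz => dy_congr (h.eventuallyEq_of_mem (hU.mem_nhds hz))

theorem partials_eq_of_eqOn {U : Set (ℝ × ℝ)} (hU : IsOpen U) (h : Set.EqOn f g U) (hz : z ∈ U) :
    f z = g z ∧ dx f z = dx g z ∧ dy f z = dy g z ∧ dx (dx f) z = dx (dx g) z ∧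
      dy (dx f) z = dy (dx g) z ∧ dy (dy f) z = dy (dy g) z :=
  ⟨h hz, eqOn_dx hU h hz, eqOn_dy hU h hz, eqOn_dx hU (eqOn_dx hU h) hz,
    eqOn_dy hU (eqOn_dx hU h) hz, eqOn_dy hU (eqOn_dy hU h) hz⟩

theorem dx_add (hf : DifferentiableAt ℝ f z) (hg : DifferentiableAt ℝ g z) :
    dx (fun w => f w + g w) z = dx f z + dx g z :=
  ((hasDerivAt_dx hf).add (hasDerivAt_dx hg)).deriv

theorem dy_add (hf : DifferentiableAt ℝ f z) (hg : DifferentiableAt ℝ g z) :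
    dy (fun w => f w + g w) z = dy f z + dy g z :=
  ((hasDerivAt_dy hf).add (hasDerivAt_dy hg)).deriv

theorem dx_const_mul (k : ℝ) (f : ℝ × ℝ → ℝ) :
    dx (fun w => k * f w) = fun w => k * dx f w :=
  funext fun _ => deriv_const_mul_field k

theorem dy_const_mul (k : ℝ) (f : ℝ × ℝ → ℝ) :
    dy (fun w => k * f w) = fun w => k * dy f w :=
  funext fun _ => deriv_const_mul_field k

theorem dx_mul (hf : DifferentiableAt ℝ f z) (hg : DifferentiableAt ℝ g z) :
    dx (fun w => f w * g w) z = dx f z * g z + f z * dx g z :=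
  ((hasDerivAt_dx hf).mul (hasDerivAt_dx hg)).deriv

theorem dy_mul (hf : DifferentiableAt ℝ f z) (hg : DifferentiableAt ℝ g z) :
    dy (fun w => f w * g w) z = dy f z * g z + f z * dy g z :=
  ((hasDerivAt_dy hf).mul (hasDerivAt_dy hg)).deriv

theorem dx_div (hf : DifferentiableAt ℝ f z) (hg : DifferentiableAt ℝ g z) (h₀ : g z ≠ 0) :
    dx (fun w => f w / g w) z = (dx f z * g z - f z * dx g z) / g z ^ 2 :=
  ((hasDerivAt_dx hf).div (hasDerivAt_dx hg) h₀).deriv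

theorem dy_div (hf : DifferentiableAt ℝ f z) (hg : DifferentiableAt ℝ g z) (h₀ : g z ≠ 0) :
    dy (fun w => f w / g w) z = (dy f z * g z - f z * dy g z) / g z ^ 2 :=
  ((hasDerivAt_dy hf).div (hasDerivAt_dy hg) h₀).deriv

theorem eventuallyEq_dx_fderiv (hf : ContDiffAt ℝ 1 f z) :
    dx f =ᶠ[𝓝 z] fun w => fderiv ℝ f w (1, 0) := by
  filter_upwards [hf.eventually (by simp)] with w hw
  exact dx_eq_fderiv (hw.differentiableAt one_ne_zero)

theorem eventuallyEq_dy_fderiv (hf : ContDiffAt ℝ 1 f z) :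
    dy f =ᶠ[𝓝 z] fun w => fderiv ℝ f w (0, 1) := by
  filter_upwards [hf.eventually (by simp)] with w hw
  exact dy_eq_fderiv (hw.differentiableAt one_ne_zero)

theorem contDiffAt_dx {m n : ℕ∞ω} (hf : ContDiffAt ℝ n f z) (hmn : m + 1 ≤ n) :
    ContDiffAt ℝ m (dx f) z :=
  ((hf.fderiv_right hmn).clm_apply contDiffAt_const).congr_of_eventuallyEq
    (eventuallyEq_dx_fderiv (hf.of_le (le_add_self.trans hmn)))

theorem contDiffAt_dy {m n : ℕ∞ω} (hf : ContDiffAt ℝ n f z) (hmn : m + 1 ≤ n) :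
    ContDiffAt ℝ m (dy f) z :=
  ((hf.fderiv_right hmn).clm_apply contDiffAt_const).congr_of_eventuallyEq
    (eventuallyEq_dy_fderiv (hf.of_le (le_add_self.trans hmn)))

theorem contDiffOn_dx {U : Set (ℝ × ℝ)} (hU : IsOpen U) (hf : ContDiffOn ℝ ∞ f U) :
    ContDiffOn ℝ ∞ (dx f) U :=
  fun _ hz => (contDiffAt_dx (hf.contDiffAt (hU.mem_nhds hz)) le_rfl).contDiffWithinAt

theorem contDiffOn_dy {U : Set (ℝ × ℝ)} (hU : IsOpen U) (hf : ContDiffOn ℝ ∞ f U) :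
    ContDiffOn ℝ ∞ (dy f) U :=
  fun _ hz => (contDiffAt_dy (hf.contDiffAt (hU.mem_nhds hz)) le_rfl).contDiffWithinAt

theorem dx_dy_comm (hf : ContDiffAt ℝ 2 f z) : dx (dy f) z = dy (dx f) z := by
  have hf' : DifferentiableAt ℝ (fderiv ℝ f) z :=
    (hf.fderiv_right (m := 1) (by norm_num)).differentiableAt one_ne_zero
  have h1 : ContDiffAt ℝ 1 f z := hf.of_le one_le_two
  rw [dx_congr (eventuallyEq_dy_fderiv h1), dy_congr (eventuallyEq_dx_fderiv h1),
    dx_eq_fderiv (hf'.clm_apply (differentiableAt_const _)),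
    dy_eq_fderiv (hf'.clm_apply (differentiableAt_const _)),
    fderiv_clm_apply hf' (differentiableAt_const _),
    fderiv_clm_apply hf' (differentiableAt_const _)]
  simpa using (hf.isSymmSndFDerivAt (by simp)).eq (1, 0) (0, 1)

theorem eventuallyEq_dx_mul (hf : ContDiffAt ℝ 1 f z) (hg : ContDiffAt ℝ 1 g z) :
    dx (fun w => f w * g w) =ᶠ[𝓝 z] fun w => dx f w * g w + f w * dx g w := by
  filter_upwards [hf.eventually (by simp), hg.eventually (by simp)] with w hfw hgw
  exact dx_mul (hfw.differentiableAt one_ne_zero) (hgw.differentiableAt one_ne_zero)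

theorem eventuallyEq_dy_mul (hf : ContDiffAt ℝ 1 f z) (hg : ContDiffAt ℝ 1 g z) :
    dy (fun w => f w * g w) =ᶠ[𝓝 z] fun w => dy f w * g w + f w * dy g w := by
  filter_upwards [hf.eventually (by simp), hg.eventually (by simp)] with w hfw hgw
  exact dy_mul (hfw.differentiableAt one_ne_zero) (hgw.differentiableAt one_ne_zero)

theorem dx_dx_mul (hf : ContDiffAt ℝ 2 f z) (hg : ContDiffAt ℝ 2 g z) :
    dx (dx fun w => f w * g w) z =
      dx (dx f) z * g z + 2 * (dx f z * dx g z) + f z * dx (dx g) z := by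
  have hfd := hf.differentiableAt two_ne_zero
  have hgd := hg.differentiableAt two_ne_zero
  have hfx := (contDiffAt_dx (m := 1) hf (by norm_num)).differentiableAt one_ne_zero
  have hgx := (contDiffAt_dx (m := 1) hg (by norm_num)).differentiableAt one_ne_zero
  rw [dx_congr (eventuallyEq_dx_mul (hf.of_le one_le_two) (hg.of_le one_le_two)),
    dx_add (hfx.fun_mul hgd) (hfd.fun_mul hgx), dx_mul hfx hgd, dx_mul hfd hgx]
  ring

theorem dy_dx_mul (hf : ContDiffAt ℝ 2 f z) (hg : ContDiffAt ℝ 2 g z) :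
    dy (dx fun w => f w * g w) z =
      dy (dx f) z * g z + dx f z * dy g z + dy f z * dx g z + f z * dy (dx g) z := by
  have hfd := hf.differentiableAt two_ne_zero
  have hgd := hg.differentiableAt two_ne_zero
  have hfx := (contDiffAt_dx (m := 1) hf (by norm_num)).differentiableAt one_ne_zero
  have hgx := (contDiffAt_dx (m := 1) hg (by norm_num)).differentiableAt one_ne_zero
  rw [dy_congr (eventuallyEq_dx_mul (hf.of_le one_le_two) (hg.of_le one_le_two)),
    dy_add (hfx.fun_mul hgd) (hfd.fun_mul hgx), dy_mul hfx hgd, dy_mul hfd hgx]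
  ring

theorem dy_dy_mul (hf : ContDiffAt ℝ 2 f z) (hg : ContDiffAt ℝ 2 g z) :
    dy (dy fun w => f w * g w) z =
      dy (dy f) z * g z + 2 * (dy f z * dy g z) + f z * dy (dy g) z := by
  have hfd := hf.differentiableAt two_ne_zero
  have hgd := hg.differentiableAt two_ne_zero
  have hfy := (contDiffAt_dy (m := 1) hf (by norm_num)).differentiableAt one_ne_zero
  have hgy := (contDiffAt_dy (m := 1) hg (by norm_num)).differentiableAt one_ne_zero
  rw [dy_congr (eventuallyEq_dy_mul (hf.of_le one_le_two) (hg.of_le one_le_two)),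
    dy_add (hfy.fun_mul hgd) (hfd.fun_mul hgy), dy_mul hfy hgd, dy_mul hfd hgy]
  ring

end PartialDerivatives

/-! ### Jets of functions of one variable -/

theorem hasDerivAt_iteratedDeriv {y : ℝ → ℝ} {n k : ℕ} {x : ℝ} (hy : ContDiffAt ℝ n y x)
    (hk : k < n) : HasDerivAt (iteratedDeriv k y) (iteratedDeriv (k + 1) y x) x := by
  have h : ContDiffAt ℝ 1 (iteratedFDeriv ℝ k y) x :=
    hy.iteratedFDeriv_right (by exact_mod_cast Nat.one_add_le_iff.2 hk)
  rw [iteratedDeriv_succ, hasDerivAt_deriv_iff, iteratedDeriv_eq_equiv_comp]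
  exact (LinearIsometryEquiv.differentiable _).differentiableAt.comp x
    (h.differentiableAt one_ne_zero)

theorem iteratedDeriv_two_eq_of_hasDerivAt {f f' : ℝ → ℝ} {f'' x : ℝ}
    (h : ∀ᶠ t in 𝓝 x, HasDerivAt f (f' t) t) (h' : HasDerivAt f' f'' x) :
    iteratedDeriv 2 f x = f'' := by
  have hderiv : deriv f =ᶠ[𝓝 x] f' := h.mono fun t ht => ht.deriv
  rw [iteratedDeriv_succ, iteratedDeriv_one, hderiv.deriv_eq, h'.deriv]

theorem exists_contDiff_iteratedDeriv_eq (n : ℕ) (x : ℝ) (a : ℕ → ℝ) :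
    ∃ y : ℝ → ℝ, ContDiff ℝ ∞ y ∧ ∀ k < n, iteratedDeriv k y x = a k := by
  refine ⟨fun t => ∑ i ∈ Finset.range n, a i / i.factorial * (t - x) ^ i, by fun_prop,
    fun k hk => ?_⟩
  rw [iteratedDeriv_comp_sub_const k (fun t => ∑ i ∈ Finset.range n, a i / i.factorial * t ^ i)]
  beta_reduce
  rw [sub_self, iteratedDeriv_fun_sum fun i _ => by fun_prop,
    Finset.sum_eq_single_of_mem k (Finset.mem_range.2 hk)]
  · simp [iteratedDeriv_const_mul_field, Nat.descFactorial_self, Nat.factorial_ne_zero]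
  · rintro i - hik
    rcases hik.lt_or_gt with hik | hik
    · simp [iteratedDeriv_const_mul_field, Nat.descFactorial_of_lt hik]
    · simp [iteratedDeriv_const_mul_field, (Nat.sub_pos_of_lt hik).ne']

theorem exists_contDiff_jet_eq (x y₀ p q r s : ℝ) :
    ∃ y : ℝ → ℝ, ContDiff ℝ ∞ y ∧ y x = y₀ ∧ deriv y x = p ∧ iteratedDeriv 2 y x = q ∧
      iteratedDeriv 3 y x = r ∧ iteratedDeriv 4 y x = s := by
  obtain ⟨y, hy, hjet⟩ := exists_contDiff_iteratedDeriv_eq 5 x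
    fun | 0 => y₀ | 1 => p | 2 => q | 3 => r | _ => s
  exact ⟨y, hy, by simpa using hjet 0, by simpa using hjet 1, hjet 2 (by norm_num),
    hjet 3 (by norm_num), hjet 4 (by norm_num)⟩

/-! ### Total derivatives of the root equation -/

/-- The total derivative of the left-hand side of the root equation, as a function on jets with
coordinates `(z, p, q, r) = ((x, y), y', y'', y''')`. -/
def RootODE.totalDeriv (E : RootODE) (z : ℝ × ℝ) (p q r : ℝ) : ℝ :=
  r + (dx E.c z + dy E.c z * p) * p ^ 3 - (dx E.g z + dy E.g z * p) * p ^ 2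
    + (dx E.h z + dy E.h z * p) * p - (dx E.d z + dy E.d z * p)
    + (3 * E.c z * p ^ 2 - 2 * E.g z * p + E.h z) * q

/-- The second total derivative of the left-hand side of the root equation, as a function on jets
with coordinates `(z, p, q, r, s) = ((x, y), y', y'', y''', y'''')`. -/
def RootODE.totalDeriv₂ (E : RootODE) (z : ℝ × ℝ) (p q r s : ℝ) : ℝ :=
  s + (dx (dx E.c) z + 2 * dy (dx E.c) z * p + dy (dy E.c) z * p ^ 2) * p ^ 3
    - (dx (dx E.g) z + 2 * dy (dx E.g) z * p + dy (dy E.g) z * p ^ 2) * p ^ 2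
    + (dx (dx E.h) z + 2 * dy (dx E.h) z * p + dy (dy E.h) z * p ^ 2) * p
    - (dx (dx E.d) z + 2 * dy (dx E.d) z * p + dy (dy E.d) z * p ^ 2)
    + (dy E.c z * p ^ 3 - dy E.g z * p ^ 2 + dy E.h z * p - dy E.d z) * q
    + 2 * (3 * (dx E.c z + dy E.c z * p) * p ^ 2 - 2 * (dx E.g z + dy E.g z * p) * p
      + (dx E.h z + dy E.h z * p)) * q
    + (6 * E.c z * p - 2 * E.g z) * q ^ 2
    + (3 * E.c z * p ^ 2 - 2 * E.g z * p + E.h z) * r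

theorem hasDerivAt_dx_add_dy_mul_deriv {f : ℝ × ℝ → ℝ} {y : ℝ → ℝ} {x : ℝ}
    (hf : ContDiffAt ℝ 2 f (x, y x)) (h₀ : HasDerivAt y (deriv y x) x)
    (h₁ : HasDerivAt (deriv y) (iteratedDeriv 2 y x) x) :
    HasDerivAt (fun t => dx f (t, y t) + dy f (t, y t) * deriv y t)
      (dx (dx f) (x, y x) + 2 * dy (dx f) (x, y x) * deriv y x
        + dy (dy f) (x, y x) * deriv y x ^ 2 + dy f (x, y x) * iteratedDeriv 2 y x) x := by
  have hfx := (contDiffAt_dx (m := 1) hf (by norm_num)).differentiableAt one_ne_zero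
  have hfy := (contDiffAt_dy (m := 1) hf (by norm_num)).differentiableAt one_ne_zero
  refine ((hasDerivAt_comp_graph hfx h₀).fun_add
    ((hasDerivAt_comp_graph hfy h₀).fun_mul h₁)).congr_deriv ?_
  rw [dx_dy_comm hf]
  ring

namespace RootODE

variable {E : RootODE} {U : Set (ℝ × ℝ)} {y : ℝ → ℝ} {x : ℝ}

theorem hasDerivAt_lhs (hE : E.SmoothOn U) (hU : U ∈ 𝓝 (x, y x)) (hy : ContDiffAt ℝ 3 y x) :
    HasDerivAt (E.lhs y)
      (E.totalDeriv (x, y x) (deriv y x) (iteratedDeriv 2 y x) (iteratedDeriv 3 y x)) x := by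
  have h₀ : HasDerivAt y (deriv y x) x := (hy.differentiableAt (by norm_num)).hasDerivAt
  have h₁ : HasDerivAt (deriv y) (iteratedDeriv 2 y x) x := by
    simpa using hasDerivAt_iteratedDeriv (k := 1) (n := 3) hy (by norm_num)
  have h₂ : HasDerivAt (iteratedDeriv 2 y) (iteratedDeriv 3 y x) x :=
    hasDerivAt_iteratedDeriv (n := 3) hy (by norm_num)
  have along : ∀ {f : ℝ × ℝ → ℝ}, ContDiffOn ℝ ∞ f U →
      HasDerivAt (fun t => f (t, y t)) (dx f (x, y x) + dy f (x, y x) * deriv y x) x := fun hf =>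
    hasDerivAt_comp_graph ((hf.contDiffAt hU).differentiableAt (by simp)) h₀
  obtain ⟨hc, hg, hh, hd⟩ := hE
  refine ((((h₂.fun_add ((along hc).fun_mul (h₁.fun_pow 3))).fun_sub
    ((along hg).fun_mul (h₁.fun_pow 2))).fun_add ((along hh).fun_mul h₁)).fun_sub
    (along hd)).congr_deriv ?_
  simp only [totalDeriv]
  push_cast
  ring

theorem hasDerivAt_totalDeriv (hE : E.SmoothOn U) (hU : U ∈ 𝓝 (x, y x))
    (hy : ContDiffAt ℝ 4 y x) :
    HasDerivAt (fun t =>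
        E.totalDeriv (t, y t) (deriv y t) (iteratedDeriv 2 y t) (iteratedDeriv 3 y t))
      (E.totalDeriv₂ (x, y x) (deriv y x) (iteratedDeriv 2 y x) (iteratedDeriv 3 y x)
        (iteratedDeriv 4 y x)) x := by
  have h₀ : HasDerivAt y (deriv y x) x := (hy.differentiableAt (by norm_num)).hasDerivAt
  have h₁ : HasDerivAt (deriv y) (iteratedDeriv 2 y x) x := by
    simpa using hasDerivAt_iteratedDeriv (k := 1) (n := 4) hy (by norm_num)
  have h₂ : HasDerivAt (iteratedDeriv 2 y) (iteratedDeriv 3 y x) x :=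
    hasDerivAt_iteratedDeriv (n := 4) hy (by norm_num)
  have h₃ : HasDerivAt (iteratedDeriv 3 y) (iteratedDeriv 4 y x) x :=
    hasDerivAt_iteratedDeriv (n := 4) hy (by norm_num)
  have along : ∀ {f : ℝ × ℝ → ℝ}, ContDiffOn ℝ ∞ f U →
      HasDerivAt (fun t => f (t, y t)) (dx f (x, y x) + dy f (x, y x) * deriv y x) x := fun hf =>
    hasDerivAt_comp_graph ((hf.contDiffAt hU).differentiableAt (by simp)) h₀
  have along₂ : ∀ {f : ℝ × ℝ → ℝ}, ContDiffOn ℝ ∞ f U →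
      HasDerivAt (fun t => dx f (t, y t) + dy f (t, y t) * deriv y t)
        (dx (dx f) (x, y x) + 2 * dy (dx f) (x, y x) * deriv y x
          + dy (dy f) (x, y x) * deriv y x ^ 2 + dy f (x, y x) * iteratedDeriv 2 y x) x :=
    fun hf => hasDerivAt_dx_add_dy_mul_deriv ((contDiffOn_infty.1 hf 2).contDiffAt hU) h₀ h₁
  obtain ⟨hc, hg, hh, hd⟩ := hE
  refine (((((h₃.fun_add ((along₂ hc).fun_mul (h₁.fun_pow 3))).fun_sub
    ((along₂ hg).fun_mul (h₁.fun_pow 2))).fun_add ((along₂ hh).fun_mul h₁)).fun_sub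
    (along₂ hd)).fun_add ((((((along hc).const_mul 3).fun_mul (h₁.fun_pow 2)).fun_sub
      (((along hg).const_mul 2).fun_mul h₁)).fun_add (along hh)).fun_mul h₂)).congr_deriv ?_
  simp only [totalDeriv₂]
  push_cast
  ring

theorem iteratedDeriv_two_lhs (hE : E.SmoothOn U) (hU : U ∈ 𝓝 (x, y x))
    (hy : ContDiffAt ℝ 4 y x) :
    iteratedDeriv 2 (E.lhs y) x = E.totalDeriv₂ (x, y x) (deriv y x) (iteratedDeriv 2 y x)
      (iteratedDeriv 3 y x) (iteratedDeriv 4 y x) := by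
  have hgraph : ContinuousAt (fun t => (t, y t)) x := continuousAt_id.prodMk hy.continuousAt
  refine iteratedDeriv_two_eq_of_hasDerivAt ?_ (hasDerivAt_totalDeriv hE hU hy)
  filter_upwards [hgraph.eventually (eventually_mem_nhds_iff.2 hU), hy.eventually (by simp)]
    with t hUt hyt
  exact hasDerivAt_lhs hE hUt (hyt.of_le (by norm_num))

end RootODE

/-! ### The prolongation of the root equation -/

theorem coeffs_eq_zero_of_sextic {a₀ a₁ a₂ a₃ a₄ a₅ a₆ : ℝ}
    (h : ∀ p, a₆ * p ^ 6 + a₅ * p ^ 5 + a₄ * p ^ 4 + a₃ * p ^ 3 + a₂ * p ^ 2 + a₁ * p + a₀ = 0) :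
    a₀ = 0 ∧ a₁ = 0 ∧ a₂ = 0 ∧ a₃ = 0 ∧ a₄ = 0 ∧ a₅ = 0 ∧ a₆ = 0 := by
  have h₀ := h 0
  have h₁ := h 1
  have h₁' := h (-1)
  have h₂ := h 2
  have h₂' := h (-2)
  have h₃ := h 3
  have h₃' := h (-3)
  norm_num at h₀ h₁ h₁' h₂ h₂' h₃ h₃'
  refine ⟨?_, ?_, ?_, ?_, ?_, ?_, ?_⟩ <;> linarith

namespace QuadODE

variable {F G : QuadODE} {z : ℝ × ℝ}

/-- The left-hand side of the fourth-order equation without `y''''`, as a function on jets with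
coordinates `(z, p, q) = ((x, y), y', y'')`. -/
def lowerTerms (F : QuadODE) (z : ℝ × ℝ) (p q : ℝ) : ℝ :=
  (F.Q1 z * p - F.Q0 z) * q ^ 2
    - (F.R4 z * p ^ 4 - F.R3 z * p ^ 3 + F.R2 z * p ^ 2 - F.R1 z * p + F.R0 z) * q
    - (F.S6 z * p ^ 6 - F.S5 z * p ^ 5 + F.S4 z * p ^ 4 - F.S3 z * p ^ 3 + F.S2 z * p ^ 2
      - F.S1 z * p + F.S0 z)

theorem lhs_eq_add_lowerTerms (F : QuadODE) (y : ℝ → ℝ) (x : ℝ) :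
    F.lhs y x = iteratedDeriv 4 y x
      + F.lowerTerms (x, y x) (deriv y x) (iteratedDeriv 2 y x) := by
  simp only [lhs, lowerTerms]
  ring

/-- Two fourth-order equations have the same coefficients at the point `z`. -/
structure CoeffEqAt (F G : QuadODE) (z : ℝ × ℝ) : Prop where
  Q0 : F.Q0 z = G.Q0 z
  Q1 : F.Q1 z = G.Q1 z
  R0 : F.R0 z = G.R0 z
  R1 : F.R1 z = G.R1 z
  R2 : F.R2 z = G.R2 z
  R3 : F.R3 z = G.R3 z
  R4 : F.R4 z = G.R4 z
  S0 : F.S0 z = G.S0 z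
  S1 : F.S1 z = G.S1 z
  S2 : F.S2 z = G.S2 z
  S3 : F.S3 z = G.S3 z
  S4 : F.S4 z = G.S4 z
  S5 : F.S5 z = G.S5 z
  S6 : F.S6 z = G.S6 z

theorem lowerTerms_eq_iff : F.lowerTerms z = G.lowerTerms z ↔ F.CoeffEqAt G z := by
  constructor
  · intro h
    have key : ∀ p q, F.lowerTerms z p q = G.lowerTerms z p q := fun p q => by rw [h]
    simp only [lowerTerms] at key
    -- `q = 0` isolates the part without `q`; the odd and even parts at `q = ±1` give the rest.
    obtain ⟨s₀, s₁, s₂, s₃, s₄, s₅, s₆⟩ := coeffs_eq_zero_of_sextic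
      (a₀ := F.S0 z - G.S0 z) (a₁ := -(F.S1 z - G.S1 z)) (a₂ := F.S2 z - G.S2 z)
      (a₃ := -(F.S3 z - G.S3 z)) (a₄ := F.S4 z - G.S4 z) (a₅ := -(F.S5 z - G.S5 z))
      (a₆ := F.S6 z - G.S6 z) fun p => by linear_combination -key p 0
    obtain ⟨r₀, r₁, r₂, r₃, r₄, -⟩ := coeffs_eq_zero_of_sextic
      (a₀ := F.R0 z - G.R0 z) (a₁ := -(F.R1 z - G.R1 z)) (a₂ := F.R2 z - G.R2 z)
      (a₃ := -(F.R3 z - G.R3 z)) (a₄ := F.R4 z - G.R4 z) (a₅ := 0) (a₆ := 0)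
      fun p => by linear_combination (key p (-1) - key p 1) / 2
    obtain ⟨q₀, q₁, -⟩ := coeffs_eq_zero_of_sextic
      (a₀ := -(F.Q0 z - G.Q0 z)) (a₁ := F.Q1 z - G.Q1 z)
      (a₂ := 0) (a₃ := 0) (a₄ := 0) (a₅ := 0) (a₆ := 0)
      fun p => by linear_combination (key p 1 + key p (-1)) / 2 - key p 0
    constructor <;> linarith
  · intro h
    funext p q
    simp only [lowerTerms, h.Q0, h.Q1, h.R0, h.R1, h.R2, h.R3, h.R4, h.S0, h.S1, h.S2, h.S3,
      h.S4, h.S5, h.S6]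

end QuadODE

namespace RootODE

variable {U : Set (ℝ × ℝ)} {E : RootODE}

/-- The fourth-order equation obtained by differentiating the root equation twice and eliminating
`y'''` by means of the once differentiated equation. -/
def prolongation (E : RootODE) : QuadODE where
  Q0 z := 2 * E.g z
  Q1 z := 6 * E.c z
  R0 z := E.h z ^ 2 + dy E.d z - 2 * dx E.h z
  R1 z := 4 * E.g z * E.h z + 3 * dy E.h z - 4 * dx E.g z
  R2 z := 4 * E.g z ^ 2 + 6 * E.c z * E.h z + 5 * dy E.g z - 6 * dx E.c z
  R3 z := 12 * E.c z * E.g z + 7 * dy E.c z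
  R4 z := 9 * E.c z ^ 2
  S0 z := dx (dx E.d) z - E.h z * dx E.d z
  S1 z := dx (dx E.h) z - 2 * dy (dx E.d) z - 2 * E.g z * dx E.d z
    - E.h z * (dx E.h z - dy E.d z)
  S2 z := dx (dx E.g) z - 2 * dy (dx E.h) z + dy (dy E.d) z - 3 * E.c z * dx E.d z
    - 2 * E.g z * (dx E.h z - dy E.d z) + E.h z * (dy E.h z - dx E.g z)
  S3 z := dx (dx E.c) z - 2 * dy (dx E.g) z + dy (dy E.h) z
    - 3 * E.c z * (dx E.h z - dy E.d z) + 2 * E.g z * (dy E.h z - dx E.g z)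
    - E.h z * (dx E.c z - dy E.g z)
  S4 z := -2 * dy (dx E.c) z + dy (dy E.g) z + 3 * E.c z * (dy E.h z - dx E.g z)
    - 2 * E.g z * (dx E.c z - dy E.g z) + E.h z * dy E.c z
  S5 z := dy (dy E.c) z - 3 * E.c z * (dx E.c z - dy E.g z) + 2 * E.g z * dy E.c z
  S6 z := 3 * E.c z * dy E.c z

theorem totalDeriv₂_eq_of_totalDeriv_eq_zero {z : ℝ × ℝ} {p q r : ℝ}
    (h : E.totalDeriv z p q r = 0) (s : ℝ) :
    E.totalDeriv₂ z p q r s = s + E.prolongation.lowerTerms z p q := by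
  simp only [totalDeriv] at h
  simp only [totalDeriv₂, QuadODE.lowerTerms, prolongation]
  linear_combination (3 * E.c z * p ^ 2 - 2 * E.g z * p + E.h z) * h

theorem iteratedDeriv_two_lhs_eq_prolongation_lhs (hE : E.SmoothOn U) {y : ℝ → ℝ} {x : ℝ}
    (hU : U ∈ 𝓝 (x, y x)) (hy : ContDiffAt ℝ 4 y x) (h : deriv (E.lhs y) x = 0) :
    iteratedDeriv 2 (E.lhs y) x = E.prolongation.lhs y x := by
  rw [(hasDerivAt_lhs hE hU (hy.of_le (by norm_num))).deriv] at h
  rw [iteratedDeriv_two_lhs hE hU hy, totalDeriv₂_eq_of_totalDeriv_eq_zero h,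
    QuadODE.lhs_eq_add_lowerTerms]

end RootODE

theorem arisesFrom_iff_coeffEqAt_prolongation {U : Set (ℝ × ℝ)} (hU : IsOpen U) {F : QuadODE}
    {E : RootODE} (hE : E.SmoothOn U) :
    ArisesFrom U F E ↔ ∀ z ∈ U, F.CoeffEqAt E.prolongation z := by
  simp only [← QuadODE.lowerTerms_eq_iff]
  constructor
  · rintro h ⟨x, y₀⟩ hz
    funext p q
    obtain ⟨y, hy, rfl, rfl, rfl, hr, -⟩ :=
      exists_contDiff_jet_eq x y₀ p q (-E.totalDeriv (x, y₀) p q 0) 0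
    have hU' := hU.mem_nhds hz
    have hy4 : ContDiffAt ℝ 4 y x := (contDiff_infty.1 hy 4).contDiffAt
    have hzero : deriv (E.lhs y) x = 0 := by
      rw [(RootODE.hasDerivAt_lhs hE hU' (hy4.of_le (by norm_num))).deriv, hr]
      simp only [RootODE.totalDeriv]
      ring
    have key := (h y hy x hz hzero).trans
      (RootODE.iteratedDeriv_two_lhs_eq_prolongation_lhs hE hU' hy4 hzero)
    simpa only [QuadODE.lhs_eq_add_lowerTerms, add_right_inj] using key
  · intro h y hy x hz hzero
    rw [RootODE.iteratedDeriv_two_lhs_eq_prolongation_lhs hE (hU.mem_nhds hz)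
      (contDiff_infty.1 hy 4).contDiffAt hzero, QuadODE.lhs_eq_add_lowerTerms,
      QuadODE.lhs_eq_add_lowerTerms, h _ hz]

namespace RootODE.IsSolution

variable {U : Set (ℝ × ℝ)} {F : QuadODE} {E : RootODE} {I : Set ℝ} {y : ℝ → ℝ}

theorem contDiffOn (hE : E.SmoothOn U) (h : E.IsSolution U I y) : ContDiffOn ℝ ∞ y I := by
  obtain ⟨hI, hy₂, hyU, hsol⟩ := h
  obtain ⟨hc, hg, hh, hd⟩ := hE
  have hdiff : DifferentiableOn ℝ (deriv y) I :=
    (hy₂.deriv_of_isOpen hI (m := 1) (by norm_num)).differentiableOn one_ne_zero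
  have hderiv : ∀ n : ℕ, ContDiffOn ℝ n y I ∧ ContDiffOn ℝ n (deriv y) I := by
    intro n
    induction n with
    | zero =>
      exact ⟨hy₂.of_le (by simp), contDiffOn_zero.2 hdiff.continuousOn⟩
    | succ n ih =>
      obtain ⟨hy, hy'⟩ := ih
      have along : ∀ {f : ℝ × ℝ → ℝ}, ContDiffOn ℝ ∞ f U →
          ContDiffOn ℝ n (fun x => f (x, y x)) I := fun hf =>
        (contDiffOn_infty.1 hf n).comp (contDiffOn_id.prodMk hy) hyU
      have hrhs : ContDiffOn ℝ n (fun x => E.d (x, y x) - E.h (x, y x) * deriv y x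
          + E.g (x, y x) * deriv y x ^ 2 - E.c (x, y x) * deriv y x ^ 3) I :=
        (((along hd).sub ((along hh).mul hy')).add ((along hg).mul (hy'.pow 2))).sub
          ((along hc).mul (hy'.pow 3))
      have hy'' : ContDiffOn ℝ n (deriv (deriv y)) I := hrhs.congr fun x hx => by
        have := hsol x hx
        rw [RootODE.lhs, iteratedDeriv_succ, iteratedDeriv_one] at this
        linarith
      exact ⟨(contDiffOn_succ_iff_deriv_of_isOpen hI).2
          ⟨hy₂.differentiableOn two_ne_zero, by simp, hy'⟩,
        (contDiffOn_succ_iff_deriv_of_isOpen hI).2 ⟨hdiff, by simp, hy''⟩⟩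
  exact contDiffOn_infty.2 fun n => (hderiv n).1

theorem quadODE (hU : IsOpen U) (hE : E.SmoothOn U)
    (hF : ∀ z ∈ U, F.CoeffEqAt E.prolongation z) (h : E.IsSolution U I y) :
    F.IsSolution U I y := by
  have hy := contDiffOn_infty.1 (h.contDiffOn hE) 4
  obtain ⟨hI, -, hyU, hsol⟩ := h
  refine ⟨hI, hy, hyU, fun x hx => ?_⟩
  have hzero : E.lhs y =ᶠ[𝓝 x] fun _ => 0 := by
    filter_upwards [hI.mem_nhds hx] with t ht using hsol t ht
  have hderiv : deriv (E.lhs y) x = 0 := by simp [hzero.deriv_eq]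
  have hiter : iteratedDeriv 2 (E.lhs y) x = 0 := by simp [hzero.iteratedDeriv_eq 2]
  rw [QuadODE.lhs_eq_add_lowerTerms, QuadODE.lowerTerms_eq_iff.2 (hF _ (hyU x hx)),
    ← QuadODE.lhs_eq_add_lowerTerms, ← hiter,
    iteratedDeriv_two_lhs_eq_prolongation_lhs hE (hU.mem_nhds (hyU x hx))
      (hy.contDiffAt (hI.mem_nhds hx)) hderiv]

end RootODE.IsSolution

/-! ### The identification, the integral formula and the constraints -/

theorem eq_integral_add_iff_dy_eq {U : Set (ℝ × ℝ)} (hU : IsOpen U) {f φ : ℝ × ℝ → ℝ}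
    (hf : ∀ z ∈ U, DifferentiableAt ℝ f z) (hφ : ContinuousOn φ U) :
    (∀ x y₁ y₂ : ℝ, (∀ t ∈ Set.uIcc y₁ y₂, (x, t) ∈ U) →
        f (x, y₂) = (∫ t in y₁..y₂, φ (x, t)) + f (x, y₁)) ↔
      ∀ z ∈ U, dy f z = φ z := by
  have hφt : ∀ x t, (x, t) ∈ U → ContinuousAt (fun t => φ (x, t)) t := fun x t hz =>
    ContinuousAt.comp (f := fun t : ℝ => (x, t)) (hφ.continuousAt (hU.mem_nhds hz))
      (Continuous.prodMk_right x).continuousAt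
  constructor
  · rintro h ⟨x, y₀⟩ hz
    obtain ⟨ε, hε, hball⟩ := Metric.mem_nhds_iff.1
      ((Continuous.prodMk_right x).continuousAt.preimage_mem_nhds (hU.mem_nhds hz))
    have hmeas : StronglyMeasurableAtFilter (fun t => φ (x, t)) (𝓝 y₀) :=
      ContinuousOn.stronglyMeasurableAtFilter isOpen_ball
        (fun t ht => (hφt x t (hball ht)).continuousWithinAt) y₀ (mem_ball_self hε)
    have hint := intervalIntegral.integral_hasDerivAt_right
      (IntervalIntegrable.refl : IntervalIntegrable _ MeasureTheory.volume y₀ y₀)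
      hmeas (hφt x y₀ hz)
    have heq : (fun t => f (x, t)) =ᶠ[𝓝 y₀] fun t => (∫ s in y₀..t, φ (x, s)) + f (x, y₀) := by
      filter_upwards [ball_mem_nhds y₀ hε] with t ht
      refine h x y₀ t fun s hs => hball ?_
      rw [mem_ball, Real.dist_eq] at ht ⊢
      exact (Set.abs_sub_left_of_mem_uIcc hs).trans_lt ht
    exact heq.deriv_eq.trans (hint.add_const _).deriv
  · intro h x y₁ y₂ hseg
    have hder : ∀ t ∈ Set.uIcc y₁ y₂, HasDerivAt (fun t => f (x, t)) (φ (x, t)) t :=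
      fun t ht => (hasDerivAt_dy (hf _ (hseg t ht))).congr_deriv (h _ (hseg t ht))
    rw [intervalIntegral.integral_eq_sub_of_hasDerivAt hder
      (ContinuousOn.intervalIntegrable fun t ht => (hφt x t (hseg t ht)).continuousWithinAt)]
    ring

section

variable {U : Set (ℝ × ℝ)} {F G : QuadODE} {E : RootODE}

theorem integralFormula_iff (hU : IsOpen U) (hE : E.SmoothOn U) (hR₀ : ContinuousOn F.R0 U) :
    IntegralFormula U F E ↔ ∀ z ∈ U, F.R0 z = E.prolongation.R0 z := by
  obtain ⟨-, -, hh, hd⟩ := hE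
  refine (eq_integral_add_iff_dy_eq (φ := fun z => F.R0 z - E.h z ^ 2 + 2 * dx E.h z) hU
    (fun z hz => (hd.contDiffAt (hU.mem_nhds hz)).differentiableAt (by simp))
    ((hR₀.sub (hh.continuousOn.pow 2)).add
      (continuousOn_const.mul (contDiffOn_dx hU hh).continuousOn))).trans
    (forall₂_congr fun z _ => ?_)
  simp only [RootODE.prolongation]
  constructor <;> intro h <;> linarith

theorem identification_and_constraints_iff_coeffEqAt (hU : IsOpen U)
    (hQ₀ : Set.EqOn F.Q0 G.Q0 U) (hQ₁ : Set.EqOn F.Q1 G.Q1 U) (hR₀ : Set.EqOn F.R0 G.R0 U)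
    (hident : Identification U G E) (hconstr : Constraints U G E) :
    Identification U F E ∧ Constraints U F E ↔ ∀ z ∈ U, F.CoeffEqAt G z := by
  constructor
  · rintro ⟨hident', hconstr'⟩ z hz
    have hG := hident z hz
    have hG' := hconstr z hz
    have hF := hident' z hz
    have hF' := hconstr' z hz
    simp only [partials_eq_of_eqOn hU hQ₀ hz, partials_eq_of_eqOn hU hQ₁ hz,
      partials_eq_of_eqOn hU hR₀ hz] at hF hF'
    obtain ⟨r₄, r₃, r₁, s₆, s₅, s₄, s₃, s₂, s₁, s₀⟩ := hG'
    rw [← r₄, ← r₃, ← r₁, ← s₆, ← s₅, ← s₄, ← s₃, ← s₂, ← s₁, ← s₀] at hF'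
    obtain ⟨r₄', r₃', r₁', s₆', s₅', s₄', s₃', s₂', s₁', s₀'⟩ := hF'
    exact ⟨hQ₀ hz, hQ₁ hz, hR₀ hz, r₁', by linarith [hF.2.2, hG.2.2], r₃', r₄', s₀', s₁', s₂', s₃',
      s₄', s₅', s₆'⟩
  · intro h
    refine ⟨fun z hz => ?_, fun z hz => ?_⟩
    · simpa only [partials_eq_of_eqOn hU hQ₀ hz, partials_eq_of_eqOn hU hQ₁ hz, (h z hz).R2]
        using hident z hz
    · simpa only [partials_eq_of_eqOn hU hQ₀ hz, partials_eq_of_eqOn hU hQ₁ hz,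
        partials_eq_of_eqOn hU hR₀ hz, (h z hz).R1, (h z hz).R3, (h z hz).R4, (h z hz).S0,
        (h z hz).S1, (h z hz).S2, (h z hz).S3, (h z hz).S4, (h z hz).S5,
        (h z hz).S6] using hconstr z hz

theorem identification_prolongation : Identification U E.prolongation E := by
  intro z _
  have hQ₀y : dy E.prolongation.Q0 z = 2 * dy E.g z := congrFun (dy_const_mul 2 E.g) z
  have hQ₁x : dx E.prolongation.Q1 z = 6 * dx E.c z := congrFun (dx_const_mul 6 E.c) z
  rw [hQ₀y, hQ₁x]
  simp only [RootODE.prolongation]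
  refine ⟨?_, ?_, ?_⟩ <;> ring

theorem dx_prolongation_R0 {z : ℝ × ℝ} (hh : ContDiffAt ℝ 2 E.h z) (hd : ContDiffAt ℝ 2 E.d z) :
    dx E.prolongation.R0 z = 2 * E.h z * dx E.h z + dy (dx E.d) z - 2 * dx (dx E.h) z := by
  rw [← dx_dy_comm hd]
  refine (((((hasDerivAt_dx (hh.differentiableAt two_ne_zero)).fun_pow 2).add
    (hasDerivAt_dx ((contDiffAt_dy (m := 1) hd (by norm_num)).differentiableAt one_ne_zero))).sub
    ((hasDerivAt_dx ((contDiffAt_dx (m := 1) hh (by norm_num)).differentiableAt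
      one_ne_zero)).const_mul 2))).deriv.trans ?_
  push_cast
  ring

theorem dy_prolongation_R0 {z : ℝ × ℝ} (hh : ContDiffAt ℝ 2 E.h z) (hd : ContDiffAt ℝ 2 E.d z) :
    dy E.prolongation.R0 z = 2 * E.h z * dy E.h z + dy (dy E.d) z - 2 * dy (dx E.h) z := by
  refine (((((hasDerivAt_dy (hh.differentiableAt two_ne_zero)).fun_pow 2).add
    (hasDerivAt_dy ((contDiffAt_dy (m := 1) hd (by norm_num)).differentiableAt one_ne_zero))).sub
    ((hasDerivAt_dy ((contDiffAt_dx (m := 1) hh (by norm_num)).differentiableAt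
      one_ne_zero)).const_mul 2))).deriv.trans ?_
  push_cast
  ring

theorem constraints_prolongation (hU : IsOpen U) (hE : E.SmoothOn U) :
    Constraints U E.prolongation E := by
  intro z hz
  have h2 : ∀ {f : ℝ × ℝ → ℝ}, ContDiffOn ℝ ∞ f U → ContDiffAt ℝ 2 f z := fun hf =>
    (contDiffOn_infty.1 hf 2).contDiffAt (hU.mem_nhds hz)
  obtain ⟨-, -, hh, hd⟩ := hE
  have q₀x : dx E.prolongation.Q0 = fun z => 2 * dx E.g z := dx_const_mul 2 E.g
  have q₀y : dy E.prolongation.Q0 = fun z => 2 * dy E.g z := dy_const_mul 2 E.g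
  have q₁x : dx E.prolongation.Q1 = fun z => 6 * dx E.c z := dx_const_mul 6 E.c
  have q₁y : dy E.prolongation.Q1 = fun z => 6 * dy E.c z := dy_const_mul 6 E.c
  simp only [dx_prolongation_R0 (h2 hh) (h2 hd), dy_prolongation_R0 (h2 hh) (h2 hd),
    q₀x, q₀y, q₁x, q₁y, dx_const_mul, dy_const_mul]
  simp only [RootODE.prolongation]
  refine ⟨?_, ?_, ?_, ?_, ?_, ?_, ?_, ?_, ?_, trivial⟩ <;> ring

theorem coeffEqAt_prolongation_iff (hU : IsOpen U) (hE : E.SmoothOn U)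
    (hR₀ : ContinuousOn F.R0 U) :
    (∀ z ∈ U, F.CoeffEqAt E.prolongation z) ↔
      Identification U F E ∧ IntegralFormula U F E ∧ Constraints U F E := by
  have key := fun hQ₀ hQ₁ hR₀ => identification_and_constraints_iff_coeffEqAt (F := F) hU
    hQ₀ hQ₁ hR₀ (identification_prolongation (E := E)) (constraints_prolongation hU hE)
  rw [integralFormula_iff hU hE hR₀]
  constructor
  · intro h
    obtain ⟨hident, hconstr⟩ :=
      (key (fun z hz => (h z hz).Q0) (fun z hz => (h z hz).Q1) fun z hz => (h z hz).R0).2 h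
    exact ⟨hident, fun z hz => (h z hz).R0, hconstr⟩
  · rintro ⟨hident, hR, hconstr⟩
    refine (key (fun z hz => ?_) (fun z hz => ?_) hR).1 ⟨hident, hconstr⟩
    · simp only [RootODE.prolongation]
      linarith [(hident z hz).2.1]
    · simp only [RootODE.prolongation]
      linarith [(hident z hz).1]

theorem arisesFrom_iff (hU : IsOpen U) (hE : E.SmoothOn U) (hR₀ : ContinuousOn F.R0 U) :
    ArisesFrom U F E ↔ Identification U F E ∧ IntegralFormula U F E ∧ Constraints U F E := by
  rw [arisesFrom_iff_coeffEqAt_prolongation hU hE, coeffEqAt_prolongation_iff hU hE hR₀]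

end

/-! ### Total derivatives -/

section

variable {X : Type*} [NormedAddCommGroup X] [NormedSpace ℝ X] {G : X → ℝ} {j v : X}

theorem eq_add_mul_of_fderiv_apply_eq {k : ℝ} (hG : ∀ t : ℝ, DifferentiableAt ℝ G (j + t • v))
    (h : ∀ t : ℝ, fderiv ℝ G (j + t • v) v = k) (t : ℝ) : G (j + t • v) = G j + k * t := by
  have hderiv : ∀ s, HasDerivAt (fun s => G (j + s • v) - k * s) 0 s := fun s => by
    have hline : HasDerivAt (fun s : ℝ => j + s • v) v s := by
      simpa using ((hasDerivAt_id s).smul_const v).const_add j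
    simpa [h s] using ((hG s).hasFDerivAt.comp_hasDerivAt s hline).fun_sub
      ((hasDerivAt_id s).const_mul k)
  have hconst := is_const_of_deriv_eq_zero (fun s => (hderiv s).differentiableAt)
    (fun s => (hderiv s).deriv) t 0
  simp only [zero_smul, add_zero, mul_zero, sub_zero] at hconst
  linarith

theorem fderiv_apply_of_eventuallyEq_comp_add {T : X →L[ℝ] X} {ℓ : X →L[ℝ] ℝ}
    (h : G =ᶠ[𝓝 j] fun i => G (T i) + ℓ i) (hG : DifferentiableAt ℝ G (T j)) (v : X) :
    fderiv ℝ G j v = fderiv ℝ G (T j) (T v) + ℓ v := by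
  have hG' : HasFDerivAt (fun i => G (T i)) ((fderiv ℝ G (T j)).comp T) j :=
    hG.hasFDerivAt.comp j T.hasFDerivAt
  rw [h.fderiv_eq, (hG'.fun_add ℓ.hasFDerivAt).fderiv]
  rfl

end

/-- `G` is a function on 3-jets over `U`, with coordinates
`(z, p, q, r) = ((x, y), y', y'', y''')`, whose total derivative is `y'''' + L(x, y, y', y'')`. -/
def IsJetPrimitive (U : Set (ℝ × ℝ)) (L : ℝ × ℝ → ℝ → ℝ → ℝ)
    (G : (ℝ × ℝ) × ℝ × ℝ × ℝ → ℝ) : Prop :=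
  ∀ z ∈ U, ∀ p q r, DifferentiableAt ℝ G (z, p, q, r) ∧
    ∀ s, fderiv ℝ G (z, p, q, r) ((1, p), q, r, s) = s + L z p q

namespace IsJetPrimitive

variable {U : Set (ℝ × ℝ)} {L : ℝ × ℝ → ℝ → ℝ → ℝ} {G : (ℝ × ℝ) × ℝ × ℝ × ℝ → ℝ} {z : ℝ × ℝ}

theorem eq_apply_zero_add (h : IsJetPrimitive U L G) (hz : z ∈ U) (p q r : ℝ) :
    G (z, p, q, r) = G (z, p, q, 0) + r := by
  have hline : ∀ t : ℝ, ((z, p, q, 0) : (ℝ × ℝ) × ℝ × ℝ × ℝ) + t • (0, 0, 0, 1) = (z, p, q, t) := by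
    simp
  have key := eq_add_mul_of_fderiv_apply_eq (G := G) (k := 1)
    (fun t => by rw [hline]; exact (h z hz p q t).1) (fun t => by
      have hv : ((0, 0, 0, 1) : (ℝ × ℝ) × ℝ × ℝ × ℝ) = ((1, p), q, t, 1) - ((1, p), q, t, 0) := by
        ext <;> simp
      rw [hline, hv, map_sub, (h z hz p q t).2, (h z hz p q t).2]
      ring) r
  rwa [hline, one_mul] at key

theorem fderiv_apply_zero (hU : IsOpen U) (h : IsJetPrimitive U L G) (hz : z ∈ U)
    (p q r : ℝ) : fderiv ℝ G (z, p, q, 0) ((1, p), q, r, 0) = L z p q := by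
  let T : (ℝ × ℝ) × ℝ × ℝ × ℝ →L[ℝ] (ℝ × ℝ) × ℝ × ℝ × ℝ :=
    (ContinuousLinearMap.id ℝ (ℝ × ℝ)).prodMap ((ContinuousLinearMap.id ℝ ℝ).prodMap
      ((ContinuousLinearMap.id ℝ ℝ).prodMap 0))
  let ℓ : (ℝ × ℝ) × ℝ × ℝ × ℝ →L[ℝ] ℝ := (ContinuousLinearMap.snd ℝ ℝ ℝ).comp
    ((ContinuousLinearMap.snd ℝ ℝ (ℝ × ℝ)).comp (ContinuousLinearMap.snd ℝ (ℝ × ℝ) (ℝ × ℝ × ℝ)))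
  have hG : G =ᶠ[𝓝 (z, p, q, r)] fun j => G (T j) + ℓ j := by
    filter_upwards [(hU.preimage continuous_fst).mem_nhds hz] with j hj
    exact h.eq_apply_zero_add hj j.2.1 j.2.2.1 j.2.2.2
  have key := fderiv_apply_of_eventuallyEq_comp_add hG (h z hz p q 0).1 ((1, p), q, r, 0)
  rw [(h z hz p q r).2] at key
  simpa [T, ℓ] using key.symm

theorem eq_apply_zero_zero_add (hU : IsOpen U) (h : IsJetPrimitive U L G) (hz : z ∈ U)
    (p q r : ℝ) : G (z, p, q, r) = G (z, p, 0, 0) + r := by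
  have hline : ∀ t : ℝ, ((z, p, 0, 0) : (ℝ × ℝ) × ℝ × ℝ × ℝ) + t • (0, 0, 1, 0) = (z, p, t, 0) := by
    simp
  have key := eq_add_mul_of_fderiv_apply_eq (G := G) (k := 0)
    (fun t => by rw [hline]; exact (h z hz p t 0).1) (fun t => by
      have hv : ((0, 0, 1, 0) : (ℝ × ℝ) × ℝ × ℝ × ℝ) = ((1, p), t, 1, 0) - ((1, p), t, 0, 0) := by
        ext <;> simp
      rw [hline, hv, map_sub, h.fderiv_apply_zero hU hz, h.fderiv_apply_zero hU hz, sub_self]) q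
  rw [hline, zero_mul, add_zero] at key
  rw [h.eq_apply_zero_add hz, key]

theorem exists_eq_add_mul (hU : IsOpen U) (h : IsJetPrimitive U L G) (hz : z ∈ U) (p : ℝ) :
    ∃ k, ∀ q, L z p q = L z p 0 + k * q := by
  let T : (ℝ × ℝ) × ℝ × ℝ × ℝ →L[ℝ] (ℝ × ℝ) × ℝ × ℝ × ℝ :=
    (ContinuousLinearMap.id ℝ (ℝ × ℝ)).prodMap ((ContinuousLinearMap.id ℝ ℝ).prodMap 0)
  let ℓ : (ℝ × ℝ) × ℝ × ℝ × ℝ →L[ℝ] ℝ := (ContinuousLinearMap.snd ℝ ℝ ℝ).comp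
    ((ContinuousLinearMap.snd ℝ ℝ (ℝ × ℝ)).comp (ContinuousLinearMap.snd ℝ (ℝ × ℝ) (ℝ × ℝ × ℝ)))
  have hG : ∀ q, G =ᶠ[𝓝 (z, p, q, 0)] fun j => G (T j) + ℓ j := fun q => by
    filter_upwards [(hU.preimage continuous_fst).mem_nhds hz] with j hj
    exact h.eq_apply_zero_zero_add hU hj j.2.1 j.2.2.1 j.2.2.2
  have hL : ∀ q, L z p q = fderiv ℝ G (z, p, 0, 0) ((1, p), q, 0, 0) := fun q => by
    have key := fderiv_apply_of_eventuallyEq_comp_add (hG q) (h z hz p 0 0).1 ((1, p), q, 0, 0)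
    rw [(h z hz p q 0).2, zero_add] at key
    simpa [T, ℓ, Prod.mk_zero_zero] using key
  refine ⟨fderiv ℝ G (z, p, 0, 0) ((0, 0), 1, 0, 0), fun q => ?_⟩
  have hq : (((1, p), q, 0, 0) : (ℝ × ℝ) × ℝ × ℝ × ℝ) =
      ((1, p), 0, 0, 0) + q • ((0, 0), 1, 0, 0) := by simp
  rw [hL, hL, hq, map_add, map_smul, smul_eq_mul, mul_comm]

end IsJetPrimitive

theorem IsTotalDerivative.exists_isJetPrimitive {U : Set (ℝ × ℝ)} (hU : IsOpen U) {F : QuadODE}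
    (h : IsTotalDerivative U F) : ∃ G, IsJetPrimitive U F.lowerTerms G := by
  obtain ⟨G, hG, hGF⟩ := h
  have hGd : ∀ z ∈ U, ∀ p q r, DifferentiableAt ℝ G (z, p, q, r) := fun z hz p q r =>
    (hG.contDiffAt ((hU.preimage continuous_fst).mem_nhds hz)).differentiableAt one_ne_zero
  refine ⟨G, fun z hz p q r => ⟨hGd z hz p q r, fun s => ?_⟩⟩
  obtain ⟨x, y₀⟩ := z
  obtain ⟨y, hy, rfl, rfl, rfl, rfl, rfl⟩ := exists_contDiff_jet_eq x y₀ p q r s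
  have hy4 : ContDiffAt ℝ (4 : ℕ) y x := (contDiff_infty.1 hy 4).contDiffAt
  have h₀ : HasDerivAt y (deriv y x) x := by
    simpa using hasDerivAt_iteratedDeriv (k := 0) hy4 (by norm_num)
  have h₁ : HasDerivAt (deriv y) (iteratedDeriv 2 y x) x := by
    simpa using hasDerivAt_iteratedDeriv (k := 1) hy4 (by norm_num)
  have h₂ := hasDerivAt_iteratedDeriv (k := 2) hy4 (by norm_num)
  have h₃ := hasDerivAt_iteratedDeriv (k := 3) hy4 (by norm_num)
  have hjet := (hGd _ hz _ _ _).hasFDerivAt.comp_hasDerivAt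
    (f := fun t => ((t, y t), deriv y t, iteratedDeriv 2 y t, iteratedDeriv 3 y t)) x
    (((hasDerivAt_id x).prodMk h₀).prodMk (h₁.prodMk (h₂.prodMk h₃)))
  rw [← QuadODE.lhs_eq_add_lowerTerms, hGF y hy x hz]
  exact hjet.deriv.symm

theorem not_isTotalDerivative {U : Set (ℝ × ℝ)} (hU : IsOpen U) {F : QuadODE}
    (h : ∃ z ∈ U, F.Q1 z ≠ 0 ∨ F.Q0 z ≠ 0) : ¬ IsTotalDerivative U F := by
  intro htotal
  obtain ⟨z, hz, hne⟩ := h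
  obtain ⟨G, hG⟩ := htotal.exists_isJetPrimitive hU
  have hquad : ∀ p, F.Q1 z * p - F.Q0 z = 0 := fun p => by
    obtain ⟨k, hk⟩ := hG.exists_eq_add_mul hU hz p
    have hpos := hk 1
    have hneg := hk (-1)
    simp only [QuadODE.lowerTerms] at hpos hneg
    linarith
  have hQ₀ := hquad 0
  have hQ₁ := hquad 1
  rcases hne with hne | hne <;> exact hne (by linarith)

/-! ### Linear systems for the second derivatives of a function -/

section ContinuousLinearMapProd

variable {G E F H : Type*} [NormedAddCommGroup G] [NormedSpace ℝ G] [NormedAddCommGroup E]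
  [NormedSpace ℝ E] [NormedAddCommGroup F] [NormedSpace ℝ F] [NormedAddCommGroup H]
  [NormedSpace ℝ H] {A : G → E →L[ℝ] F} {B : G → E →L[ℝ] H}

theorem contDiffOn_clm_prod {U : Set G} (hA : ContDiffOn ℝ ∞ A U) (hB : ContDiffOn ℝ ∞ B U) :
    ContDiffOn ℝ ∞ (fun z => (A z).prod (B z)) U :=
  (ContinuousLinearMap.prodₗᵢ (𝕜 := ℝ) (E := E) (F := F) (G := H) ℝ).contDiff.comp_contDiffOn
    (hA.prodMk hB)

theorem fderiv_clm_prod_apply {z : G} (hA : DifferentiableAt ℝ A z)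
    (hB : DifferentiableAt ℝ B z) (v : G) (w : E) :
    fderiv ℝ (fun z => (A z).prod (B z)) z v w = (fderiv ℝ A z v w, fderiv ℝ B z v w) := by
  have h := (ContinuousLinearMap.prodₗᵢ (𝕜 := ℝ) (E := E) (F := F) (G := H)
    ℝ).toContinuousLinearEquiv.hasFDerivAt.comp z (hA.hasFDerivAt.prodMk hB.hasFDerivAt)
  exact congrArg (fun L => L v w) h.fderiv

end ContinuousLinearMapProd

theorem IsTotalDifferentialSolution.dx_clm_comp {E : Type*} [NormedAddCommGroup E]
    [NormedSpace ℝ E] {A B : ℝ × ℝ → E →L[ℝ] E} {V : Set (ℝ × ℝ)} {W : ℝ × ℝ → E}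
    (hW : IsTotalDifferentialSolution A B V W) (L : E →L[ℝ] ℝ) :
    Set.EqOn (dx fun z => L (W z)) (fun z => L (A z (W z))) V := fun z hz => by
  have h := L.hasFDerivAt.comp z (hW z hz)
  exact (dx_eq_fderiv h.differentiableAt).trans ((congrArg (· (1, 0)) h.fderiv).trans (by simp))

theorem IsTotalDifferentialSolution.dy_clm_comp {E : Type*} [NormedAddCommGroup E]
    [NormedSpace ℝ E] {A B : ℝ × ℝ → E →L[ℝ] E} {V : Set (ℝ × ℝ)} {W : ℝ × ℝ → E}
    (hW : IsTotalDifferentialSolution A B V W) (L : E →L[ℝ] ℝ) :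
    Set.EqOn (dy fun z => L (W z)) (fun z => L (B z (W z))) V := fun z hz => by
  have h := L.hasFDerivAt.comp z (hW z hz)
  exact (dy_eq_fderiv h.differentiableAt).trans ((congrArg (· (0, 1)) h.fderiv).trans (by simp))

/-- `u` is a solution on `V` of the linear system that expresses `u_xx`, `u_xy` and `u_yy` by the
linear forms `α`, `β` and `γ` in `(u, u_x, u_y)`. -/
structure IsHessianSolution (α β γ : ℝ × ℝ → ℝ × ℝ × ℝ →L[ℝ] ℝ) (V : Set (ℝ × ℝ))
    (u : ℝ × ℝ → ℝ) : Prop where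
  smooth : ContDiffOn ℝ ∞ u V
  dx_dx : ∀ z ∈ V, dx (dx u) z = α z (u z, dx u z, dy u z)
  dy_dx : ∀ z ∈ V, dy (dx u) z = β z (u z, dx u z, dy u z)
  dy_dy : ∀ z ∈ V, dy (dy u) z = γ z (u z, dx u z, dy u z)

theorem exists_forall_isHessianSolution {α β γ : ℝ × ℝ → ℝ × ℝ × ℝ →L[ℝ] ℝ} {U : Set (ℝ × ℝ)}
    (hU : IsOpen U) (hα : ContDiffOn ℝ ∞ α U) (hβ : ContDiffOn ℝ ∞ β U) (hγ : ContDiffOn ℝ ∞ γ U)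
    (hαβ : ∀ z ∈ U, ∀ u v w : ℝ,
      fderiv ℝ α z (0, 1) (u, v, w) + α z (w, β z (u, v, w), γ z (u, v, w)) =
        fderiv ℝ β z (1, 0) (u, v, w) + β z (v, α z (u, v, w), β z (u, v, w)))
    (hβγ : ∀ z ∈ U, ∀ u v w : ℝ,
      fderiv ℝ β z (0, 1) (u, v, w) + β z (w, β z (u, v, w), γ z (u, v, w)) =
        fderiv ℝ γ z (1, 0) (u, v, w) + γ z (v, α z (u, v, w), β z (u, v, w)))
    {z₀ : ℝ × ℝ} (hz₀ : z₀ ∈ U) :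
    ∃ V ⊆ U, IsOpen V ∧ z₀ ∈ V ∧ ∀ u₀ v₀ w₀ : ℝ, ∃ u, IsHessianSolution α β γ V u ∧
      u z₀ = u₀ ∧ dx u z₀ = v₀ ∧ dy u z₀ = w₀ := by
  let π₁ : ℝ × ℝ × ℝ →L[ℝ] ℝ := .fst ℝ ℝ (ℝ × ℝ)
  let π₂ : ℝ × ℝ × ℝ →L[ℝ] ℝ := (ContinuousLinearMap.fst ℝ ℝ ℝ).comp (.snd ℝ ℝ (ℝ × ℝ))
  let π₃ : ℝ × ℝ × ℝ →L[ℝ] ℝ := (ContinuousLinearMap.snd ℝ ℝ ℝ).comp (.snd ℝ ℝ (ℝ × ℝ))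
  have diff : ∀ {C : ℝ × ℝ → ℝ × ℝ × ℝ →L[ℝ] ℝ}, ContDiffOn ℝ ∞ C U → ∀ z ∈ U,
      DifferentiableAt ℝ C z := fun hC z hz =>
    (hC.contDiffAt (hU.mem_nhds hz)).differentiableAt (by simp)
  have fderiv_prod : ∀ (π : ℝ × ℝ × ℝ →L[ℝ] ℝ) {C D : ℝ × ℝ → ℝ × ℝ × ℝ →L[ℝ] ℝ},
      ContDiffOn ℝ ∞ C U → ContDiffOn ℝ ∞ D U → ∀ z ∈ U, ∀ v w,
      fderiv ℝ (fun z => π.prod ((C z).prod (D z))) z v w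
        = (0, fderiv ℝ C z v w, fderiv ℝ D z v w) := fun π C D hC hD z hz v w => by
    have hCD : DifferentiableAt ℝ (fun z => (C z).prod (D z)) z :=
      ((contDiffOn_clm_prod hC hD).contDiffAt (hU.mem_nhds hz)).differentiableAt (by simp)
    rw [fderiv_clm_prod_apply (differentiableAt_const π) hCD,
      fderiv_clm_prod_apply (diff hC z hz) (diff hD z hz), fderiv_const_apply]
    simp
  obtain ⟨V, hVU, hV, hzV, hsol⟩ := exists_forall_isTotalDifferentialSolution hU
    (contDiffOn_clm_prod (contDiffOn_const (c := π₂)) (contDiffOn_clm_prod hα hβ))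
    (contDiffOn_clm_prod (contDiffOn_const (c := π₃)) (contDiffOn_clm_prod hβ hγ))
    (fun z hz ⟨u, v, w⟩ => by
      rw [fderiv_prod π₂ hα hβ z hz, fderiv_prod π₃ hβ hγ z hz]
      simpa [π₂, π₃] using ⟨hαβ z hz u v w, hβγ z hz u v w⟩) hz₀
  refine ⟨V, hVU, hV, hzV, fun u₀ v₀ w₀ => ?_⟩
  obtain ⟨W, hW₀, hWsmooth, hW⟩ := hsol (u₀, v₀, w₀)
  have hux : Set.EqOn (dx fun z => π₁ (W z)) (fun z => π₂ (W z)) V := hW.dx_clm_comp π₁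
  have huy : Set.EqOn (dy fun z => π₁ (W z)) (fun z => π₃ (W z)) V := hW.dy_clm_comp π₁
  refine ⟨fun z => π₁ (W z),
    ⟨π₁.contDiff.comp_contDiffOn hWsmooth, fun z hz => ?_, fun z hz => ?_, fun z hz => ?_⟩,
    by simp [π₁, hW₀], by simp [hux hzV, π₂, hW₀], by simp [huy hzV, π₃, hW₀]⟩
  · rw [eqOn_dx hV hux hz, hux hz, huy hz, hW.dx_clm_comp π₂ hz]; rfl
  · rw [eqOn_dy hV hux hz, hux hz, huy hz, hW.dy_clm_comp π₂ hz]; rfl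
  · rw [eqOn_dy hV huy hz, hux hz, huy hz, hW.dy_clm_comp π₃ hz]; rfl

/-- The bilinear form `(k, w) ↦ k₁ w₁ + k₂ w₂ + k₃ w₃`, which turns a triple of coefficients into a
linear form on `ℝ³`; the type `ℝ × ℝ × ℝ` carries no inner product. -/
def linForm : ℝ × ℝ × ℝ →L[ℝ] ℝ × ℝ × ℝ →L[ℝ] ℝ :=
  let π₁ := ContinuousLinearMap.fst ℝ ℝ (ℝ × ℝ)
  let π₂ := (ContinuousLinearMap.fst ℝ ℝ ℝ).comp (.snd ℝ ℝ (ℝ × ℝ))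
  let π₃ := (ContinuousLinearMap.snd ℝ ℝ ℝ).comp (.snd ℝ ℝ (ℝ × ℝ))
  (ContinuousLinearMap.mul ℝ ℝ).bilinearComp π₁ π₁
    + (ContinuousLinearMap.mul ℝ ℝ).bilinearComp π₂ π₂
    + (ContinuousLinearMap.mul ℝ ℝ).bilinearComp π₃ π₃

theorem linForm_apply (a b c u v w : ℝ) :
    linForm (a, b, c) (u, v, w) = a * u + b * v + c * w :=
  rfl

theorem fderiv_linForm_apply {G : Type*} [NormedAddCommGroup G] [NormedSpace ℝ G] {a b c : G → ℝ}
    {z : G} (ha : DifferentiableAt ℝ a z) (hb : DifferentiableAt ℝ b z)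
    (hc : DifferentiableAt ℝ c z) (s : G) :
    fderiv ℝ (fun z => linForm (a z, b z, c z)) z s
      = linForm (fderiv ℝ a z s, fderiv ℝ b z s, fderiv ℝ c z s) := by
  have h := linForm.hasFDerivAt.comp z
    (ha.hasFDerivAt.prodMk (hb.hasFDerivAt.prodMk hc.hasFDerivAt))
  exact congrArg (· s) h.fderiv

section LinForm

variable {a b c : ℝ × ℝ → ℝ} {z : ℝ × ℝ}

theorem fderiv_linForm_fst (ha : DifferentiableAt ℝ a z) (hb : DifferentiableAt ℝ b z)
    (hc : DifferentiableAt ℝ c z) :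
    fderiv ℝ (fun z => linForm (a z, b z, c z)) z (1, 0) = linForm (dx a z, dx b z, dx c z) := by
  rw [fderiv_linForm_apply ha hb hc, dx_eq_fderiv ha, dx_eq_fderiv hb, dx_eq_fderiv hc]

theorem fderiv_linForm_snd (ha : DifferentiableAt ℝ a z) (hb : DifferentiableAt ℝ b z)
    (hc : DifferentiableAt ℝ c z) :
    fderiv ℝ (fun z => linForm (a z, b z, c z)) z (0, 1) = linForm (dy a z, dy b z, dy c z) := by
  rw [fderiv_linForm_apply ha hb hc, dy_eq_fderiv ha, dy_eq_fderiv hb, dy_eq_fderiv hc]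

end LinForm

/-! ### Scales of a root equation satisfying the Lie–Tresse criteria -/

namespace RootODE

section Hess

variable (E : RootODE) (z : ℝ × ℝ)

/-- The coefficient of `u` in the equation for `u_xx` satisfied by a flat scale `u`. -/
def hessXX : ℝ :=
  dx E.h z / 3 + 2 * E.h z ^ 2 / 9 + dy E.d z - 2 * (E.d z * E.g z) / 3

/-- The coefficient of `u` in the equation for `u_xy` satisfied by a flat scale `u`. -/
def hessXY : ℝ :=
  E.c z * E.d z - E.g z * E.h z / 9 - (dy E.h z + dx E.g z) / 3

/-- The coefficient of `u` in the equation for `u_yy` satisfied by a flat scale `u`. -/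
def hessYY : ℝ :=
  dy E.g z / 3 + 2 * E.g z ^ 2 / 9 + dx E.c z - 2 * (E.c z * E.h z) / 3

end Hess

/-- `u` solves the linear system whose nonvanishing solutions are the factors that rescale the
projective connection of the root equation to a flat affine connection. The quotients of two
solutions are the coordinates that linearize the equation. -/
structure IsFlatScale (E : RootODE) (V : Set (ℝ × ℝ)) (u : ℝ × ℝ → ℝ) : Prop where
  smooth : ContDiffOn ℝ ∞ u V
  dx_dx : ∀ z ∈ V, dx (dx u) z = E.hessXX z * u z - E.h z / 3 * dx u z - E.d z * dy u z
  dy_dx : ∀ z ∈ V, dy (dx u) z = E.hessXY z * u z + E.g z / 3 * dx u z + E.h z / 3 * dy u z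
  dy_dy : ∀ z ∈ V, dy (dy u) z = E.hessYY z * u z - E.c z * dx u z - E.g z / 3 * dy u z

theorem IsFlatScale.mono {E : RootODE} {V V' : Set (ℝ × ℝ)} {u : ℝ × ℝ → ℝ}
    (h : E.IsFlatScale V u) (hV : V' ⊆ V) : E.IsFlatScale V' u :=
  ⟨h.smooth.mono hV, fun z hz => h.dx_dx z (hV hz), fun z hz => h.dy_dx z (hV hz),
    fun z hz => h.dy_dy z (hV hz)⟩

theorem SmoothOn.mono {E : RootODE} {U V : Set (ℝ × ℝ)} (hE : E.SmoothOn U) (hV : V ⊆ U) :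
    E.SmoothOn V :=
  ⟨hE.1.mono hV, hE.2.1.mono hV, hE.2.2.1.mono hV, hE.2.2.2.mono hV⟩

theorem SmoothOn.contDiffAt_two {E : RootODE} {U : Set (ℝ × ℝ)} {z : ℝ × ℝ} (hE : E.SmoothOn U)
    (hU : IsOpen U) (hz : z ∈ U) : ContDiffAt ℝ 2 E.c z ∧ ContDiffAt ℝ 2 E.g z ∧
      ContDiffAt ℝ 2 E.h z ∧ ContDiffAt ℝ 2 E.d z := by
  have at_two : ∀ {k : ℝ × ℝ → ℝ}, ContDiffOn ℝ ∞ k U → ContDiffAt ℝ 2 k z :=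
    fun hk => (contDiffOn_infty.1 hk 2).contDiffAt (hU.mem_nhds hz)
  exact ⟨at_two hE.1, at_two hE.2.1, at_two hE.2.2.1, at_two hE.2.2.2⟩

section Integrability

variable {E : RootODE} {U : Set (ℝ × ℝ)} {z : ℝ × ℝ}

theorem contDiffOn_hess (hU : IsOpen U) (hE : E.SmoothOn U) :
    ContDiffOn ℝ ∞ E.hessXX U ∧ ContDiffOn ℝ ∞ E.hessXY U ∧ ContDiffOn ℝ ∞ E.hessYY U := by
  obtain ⟨hc, hg, hh, hd⟩ := hE
  have hcx := contDiffOn_dx hU hc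
  have hgx := contDiffOn_dx hU hg
  have hgy := contDiffOn_dy hU hg
  have hhx := contDiffOn_dx hU hh
  have hhy := contDiffOn_dy hU hh
  have hdy := contDiffOn_dy hU hd
  exact ⟨(((hhx.div_const 3).add ((contDiffOn_const.mul (hh.pow 2)).div_const 9)).add hdy).sub
      ((contDiffOn_const.mul (hd.mul hg)).div_const 3),
    ((hc.mul hd).sub ((hg.mul hh).div_const 9)).sub ((hhy.add hgx).div_const 3),
    (((hgy.div_const 3).add ((contDiffOn_const.mul (hg.pow 2)).div_const 9)).add hcx).sub
      ((contDiffOn_const.mul (hc.mul hh)).div_const 3)⟩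

theorem dy_hessXX (hh : ContDiffAt ℝ 2 E.h z) (hd : ContDiffAt ℝ 2 E.d z)
    (hg : DifferentiableAt ℝ E.g z) :
    dy E.hessXX z = dy (dx E.h) z / 3 + 4 * E.h z * dy E.h z / 9 + dy (dy E.d) z
      - 2 * (dy E.d z * E.g z + E.d z * dy E.g z) / 3 := by
  have hhx := (contDiffAt_dx (m := 1) hh (by norm_num)).differentiableAt one_ne_zero
  have hdy := (contDiffAt_dy (m := 1) hd (by norm_num)).differentiableAt one_ne_zero
  refine (((((hasDerivAt_dy hhx).div_const 3).add ((((hasDerivAt_dy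
    (hh.differentiableAt two_ne_zero)).fun_pow 2).const_mul 2).div_const 9)).add
    (hasDerivAt_dy hdy)).sub ((((hasDerivAt_dy (hd.differentiableAt two_ne_zero)).fun_mul
    (hasDerivAt_dy hg)).const_mul 2).div_const 3)).deriv.trans ?_
  push_cast
  ring

theorem dx_hessYY (hg : ContDiffAt ℝ 2 E.g z) (hc : ContDiffAt ℝ 2 E.c z)
    (hh : DifferentiableAt ℝ E.h z) :
    dx E.hessYY z = dy (dx E.g) z / 3 + 4 * E.g z * dx E.g z / 9 + dx (dx E.c) z
      - 2 * (dx E.c z * E.h z + E.c z * dx E.h z) / 3 := by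
  have hgy := (contDiffAt_dy (m := 1) hg (by norm_num)).differentiableAt one_ne_zero
  have hcx := (contDiffAt_dx (m := 1) hc (by norm_num)).differentiableAt one_ne_zero
  rw [← dx_dy_comm hg]
  refine (((((hasDerivAt_dx hgy).div_const 3).add ((((hasDerivAt_dx
    (hg.differentiableAt two_ne_zero)).fun_pow 2).const_mul 2).div_const 9)).add
    (hasDerivAt_dx hcx)).sub ((((hasDerivAt_dx (hc.differentiableAt two_ne_zero)).fun_mul
    (hasDerivAt_dx hh)).const_mul 2).div_const 3)).deriv.trans ?_
  push_cast
  ring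

theorem dx_hessXY (hc : DifferentiableAt ℝ E.c z) (hd : DifferentiableAt ℝ E.d z)
    (hg : ContDiffAt ℝ 2 E.g z) (hh : ContDiffAt ℝ 2 E.h z) :
    dx E.hessXY z = dx E.c z * E.d z + E.c z * dx E.d z
      - (dx E.g z * E.h z + E.g z * dx E.h z) / 9 - (dy (dx E.h) z + dx (dx E.g) z) / 3 := by
  have hgx := (contDiffAt_dx (m := 1) hg (by norm_num)).differentiableAt one_ne_zero
  have hhy := (contDiffAt_dy (m := 1) hh (by norm_num)).differentiableAt one_ne_zero
  rw [← dx_dy_comm hh]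
  exact ((((hasDerivAt_dx hc).fun_mul (hasDerivAt_dx hd)).sub
    (((hasDerivAt_dx (hg.differentiableAt two_ne_zero)).fun_mul
      (hasDerivAt_dx (hh.differentiableAt two_ne_zero))).div_const 9)).sub
    (((hasDerivAt_dx hhy).fun_add (hasDerivAt_dx hgx)).div_const 3)).deriv

theorem dy_hessXY (hc : DifferentiableAt ℝ E.c z) (hd : DifferentiableAt ℝ E.d z)
    (hg : ContDiffAt ℝ 2 E.g z) (hh : ContDiffAt ℝ 2 E.h z) :
    dy E.hessXY z = dy E.c z * E.d z + E.c z * dy E.d z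
      - (dy E.g z * E.h z + E.g z * dy E.h z) / 9 - (dy (dy E.h) z + dy (dx E.g) z) / 3 := by
  have hgx := (contDiffAt_dx (m := 1) hg (by norm_num)).differentiableAt one_ne_zero
  have hhy := (contDiffAt_dy (m := 1) hh (by norm_num)).differentiableAt one_ne_zero
  exact ((((hasDerivAt_dy hc).fun_mul (hasDerivAt_dy hd)).sub
    (((hasDerivAt_dy (hg.differentiableAt two_ne_zero)).fun_mul
      (hasDerivAt_dy (hh.differentiableAt two_ne_zero))).div_const 9)).sub
    (((hasDerivAt_dy hhy).fun_add (hasDerivAt_dy hgx)).div_const 3)).deriv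

end Integrability

end RootODE

namespace LieTresse

variable {U : Set (ℝ × ℝ)} {E : RootODE} {z : ℝ × ℝ} {u v w r s t : ℝ}

theorem dy_dx_dx_eq_dx_dy_dx (hLT : LieTresse U E) (hU : IsOpen U) (hE : E.SmoothOn U)
    (hz : z ∈ U) (hr : r = E.hessXX z * u - E.h z / 3 * v - E.d z * w)
    (hs : s = E.hessXY z * u + E.g z / 3 * v + E.h z / 3 * w)
    (ht : t = E.hessYY z * u - E.c z * v - E.g z / 3 * w) :
    dy E.hessXX z * u - dy E.h z / 3 * v - dy E.d z * w
        + (E.hessXX z * w - E.h z / 3 * s - E.d z * t) =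
      dx E.hessXY z * u + dx E.g z / 3 * v + dx E.h z / 3 * w
        + (E.hessXY z * v + E.g z / 3 * r + E.h z / 3 * s) := by
  obtain ⟨hc, hg, hh, hd⟩ := hE.contDiffAt_two hU hz
  have hc' := hc.differentiableAt two_ne_zero
  have hg' := hg.differentiableAt two_ne_zero
  have hd' := hd.differentiableAt two_ne_zero
  have hl := (hLT z hz).2
  rw [dy_mul hd' hg'] at hl
  rw [RootODE.dy_hessXX hh hd hg', RootODE.dx_hessXY hc' hd' hg hh, hr, hs, ht]
  simp only [RootODE.hessXX, RootODE.hessXY, RootODE.hessYY]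
  linear_combination -u / 3 * hl

theorem dy_dy_dx_eq_dx_dy_dy (hLT : LieTresse U E) (hU : IsOpen U) (hE : E.SmoothOn U)
    (hz : z ∈ U) (hr : r = E.hessXX z * u - E.h z / 3 * v - E.d z * w)
    (hs : s = E.hessXY z * u + E.g z / 3 * v + E.h z / 3 * w)
    (ht : t = E.hessYY z * u - E.c z * v - E.g z / 3 * w) :
    dy E.hessXY z * u + dy E.g z / 3 * v + dy E.h z / 3 * w
        + (E.hessXY z * w + E.g z / 3 * s + E.h z / 3 * t) =
      dx E.hessYY z * u - dx E.c z * v - dx E.g z / 3 * w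
        + (E.hessYY z * v - E.c z * r - E.g z / 3 * s) := by
  obtain ⟨hc, hg, hh, hd⟩ := hE.contDiffAt_two hU hz
  have hc' := hc.differentiableAt two_ne_zero
  have hh' := hh.differentiableAt two_ne_zero
  have hd' := hd.differentiableAt two_ne_zero
  have hl := (hLT z hz).1
  rw [dx_mul hc' hh'] at hl
  rw [RootODE.dy_hessXY hc' hd' hg hh, RootODE.dx_hessYY hg hc hh', hr, hs, ht]
  simp only [RootODE.hessXX, RootODE.hessXY, RootODE.hessYY]
  linear_combination u / 3 * hl

theorem exists_forall_isFlatScale (hLT : LieTresse U E) (hU : IsOpen U) (hE : E.SmoothOn U)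
    {z₀ : ℝ × ℝ} (hz₀ : z₀ ∈ U) :
    ∃ V ⊆ U, IsOpen V ∧ z₀ ∈ V ∧ ∀ u₀ v₀ w₀ : ℝ, ∃ u, E.IsFlatScale V u ∧
      u z₀ = u₀ ∧ dx u z₀ = v₀ ∧ dy u z₀ = w₀ := by
  obtain ⟨hc, hg, hh, hd⟩ := hE
  obtain ⟨hXX, hXY, hYY⟩ := RootODE.contDiffOn_hess hU ⟨hc, hg, hh, hd⟩
  have smul : ∀ {k : ℝ × ℝ → ℝ} (r : ℝ), ContDiffOn ℝ ∞ k U →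
      ContDiffOn ℝ ∞ (fun z => r * k z) U := fun r hk => contDiffOn_const.mul hk
  have form : ∀ {a b c : ℝ × ℝ → ℝ}, ContDiffOn ℝ ∞ a U → ContDiffOn ℝ ∞ b U →
      ContDiffOn ℝ ∞ c U → ContDiffOn ℝ ∞ (fun z => linForm (a z, b z, c z)) U :=
    fun ha hb hc => linForm.contDiff.comp_contDiffOn (ha.prodMk (hb.prodMk hc))
  have diff : ∀ {k : ℝ × ℝ → ℝ}, ContDiffOn ℝ ∞ k U → ∀ z ∈ U, DifferentiableAt ℝ k z :=
    fun hk z hz => (hk.contDiffAt (hU.mem_nhds hz)).differentiableAt (by simp)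
  obtain ⟨V, hVU, hV, hzV, hsol⟩ := exists_forall_isHessianSolution hU
    (form hXX (smul (-1 / 3) hh) (smul (-1) hd)) (form hXY (smul (1 / 3) hg) (smul (1 / 3) hh))
    (form hYY (smul (-1) hc) (smul (-1 / 3) hg))
    (fun z hz u v w => by
      rw [fderiv_linForm_snd (diff hXX z hz) (diff (smul _ hh) z hz) (diff (smul _ hd) z hz),
        fderiv_linForm_fst (diff hXY z hz) (diff (smul _ hg) z hz) (diff (smul _ hh) z hz)]
      simp only [dx_const_mul, dy_const_mul, linForm_apply]
      linear_combination hLT.dy_dx_dx_eq_dx_dy_dx hU ⟨hc, hg, hh, hd⟩ hz (u := u) (v := v) (w := w)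
        rfl rfl rfl)
    (fun z hz u v w => by
      rw [fderiv_linForm_snd (diff hXY z hz) (diff (smul _ hg) z hz) (diff (smul _ hh) z hz),
        fderiv_linForm_fst (diff hYY z hz) (diff (smul _ hc) z hz) (diff (smul _ hg) z hz)]
      simp only [dx_const_mul, dy_const_mul, linForm_apply]
      linear_combination hLT.dy_dy_dx_eq_dx_dy_dy hU ⟨hc, hg, hh, hd⟩ hz (u := u) (v := v) (w := w)
        rfl rfl rfl) hz₀
  refine ⟨V, hVU, hV, hzV, fun u₀ v₀ w₀ => ?_⟩
  obtain ⟨u, hu, hu₀⟩ := hsol u₀ v₀ w₀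
  refine ⟨u, ⟨hu.smooth, fun z hz => ?_, fun z hz => ?_, fun z hz => ?_⟩, hu₀⟩
  · rw [hu.dx_dx z hz, linForm_apply]; ring
  · rw [hu.dy_dx z hz, linForm_apply]; ring
  · rw [hu.dy_dy z hz, linForm_apply]; ring

end LieTresse

/-! ### Affine coordinates -/

/-- The Jacobian determinant of the map `(X, Y)` of the plane. -/
def jacobian (X Y : ℝ × ℝ → ℝ) (z : ℝ × ℝ) : ℝ :=
  dx X z * dy Y z - dy X z * dx Y z

theorem eq_zero_of_jacobian_ne_zero {X Y : ℝ × ℝ → ℝ} {z : ℝ × ℝ} {p q : ℝ}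
    (hJ : jacobian X Y z ≠ 0) (hX : p * dx X z + q * dy X z = 0)
    (hY : p * dx Y z + q * dy Y z = 0) : p = 0 ∧ q = 0 := by
  have hp : p * jacobian X Y z = 0 := by
    rw [jacobian]
    linear_combination dy Y z * hX - dy X z * hY
  have hq : q * jacobian X Y z = 0 := by
    rw [jacobian]
    linear_combination dx X z * hY - dx Y z * hX
  exact ⟨(mul_eq_zero.1 hp).resolve_right hJ, (mul_eq_zero.1 hq).resolve_right hJ⟩

/-- `X` is an affine coordinate on `V`, that is, `dX` is parallel, for the connection with
Christoffel symbols `Γ¹₁₁ = -a, Γ¹₁₂ = -b, Γ¹₂₂ = -c, Γ²₁₁ = -d, Γ²₁₂ = -e, Γ²₂₂ = -f`. -/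
structure IsAffineCoordinate (V : Set (ℝ × ℝ)) (a b c d e f X : ℝ × ℝ → ℝ) : Prop where
  smooth : ContDiffOn ℝ ∞ X V
  dx_dx : ∀ z ∈ V, dx (dx X) z = -(a z * dx X z + d z * dy X z)
  dy_dx : ∀ z ∈ V, dy (dx X) z = -(b z * dx X z + e z * dy X z)
  dy_dy : ∀ z ∈ V, dy (dy X) z = -(c z * dx X z + f z * dy X z)

namespace IsAffineCoordinate

variable {V : Set (ℝ × ℝ)} {a b c d e f X Y : ℝ × ℝ → ℝ} {z : ℝ × ℝ}

theorem hasDerivAt_dx_dx (hX : IsAffineCoordinate V a b c d e f X) (hV : IsOpen V) (hz : z ∈ V) :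
    HasDerivAt (fun t => dx X (t, z.2)) (-(a z * dx X z + d z * dy X z)) z.1 := by
  have h := (contDiffOn_dx hV hX.smooth).contDiffAt (hV.mem_nhds hz)
  exact hX.dx_dx z hz ▸ hasDerivAt_dx (h.differentiableAt (by simp))

theorem hasDerivAt_dy_dx (hX : IsAffineCoordinate V a b c d e f X) (hV : IsOpen V) (hz : z ∈ V) :
    HasDerivAt (fun t => dx X (z.1, t)) (-(b z * dx X z + e z * dy X z)) z.2 := by
  have h := (contDiffOn_dx hV hX.smooth).contDiffAt (hV.mem_nhds hz)
  exact hX.dy_dx z hz ▸ hasDerivAt_dy (h.differentiableAt (by simp))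

theorem hasDerivAt_dx_dy (hX : IsAffineCoordinate V a b c d e f X) (hV : IsOpen V) (hz : z ∈ V) :
    HasDerivAt (fun t => dy X (t, z.2)) (-(b z * dx X z + e z * dy X z)) z.1 := by
  have h := (contDiffOn_dy hV hX.smooth).contDiffAt (hV.mem_nhds hz)
  rw [← hX.dy_dx z hz, ← dx_dy_comm ((contDiffOn_infty.1 hX.smooth 2).contDiffAt (hV.mem_nhds hz))]
  exact hasDerivAt_dx (h.differentiableAt (by simp))

theorem hasDerivAt_dy_dy (hX : IsAffineCoordinate V a b c d e f X) (hV : IsOpen V) (hz : z ∈ V) :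
    HasDerivAt (fun t => dy X (z.1, t)) (-(c z * dx X z + f z * dy X z)) z.2 := by
  have h := (contDiffOn_dy hV hX.smooth).contDiffAt (hV.mem_nhds hz)
  exact hX.dy_dy z hz ▸ hasDerivAt_dy (h.differentiableAt (by simp))

theorem curvature_apply_eq_zero (hX : IsAffineCoordinate V a b c d e f X) (hV : IsOpen V)
    (hz : z ∈ V) (ha : DifferentiableAt ℝ a z) (hb : DifferentiableAt ℝ b z)
    (hc : DifferentiableAt ℝ c z) (hd : DifferentiableAt ℝ d z) (he : DifferentiableAt ℝ e z)
    (hf : DifferentiableAt ℝ f z) :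
    (dy a z - dx b z + b z * e z - c z * d z) * dx X z
        + (dy d z - dx e z - (a z * e z - b z * d z) - (d z * f z - e z ^ 2)) * dy X z = 0 ∧
      (dy b z - dx c z + (a z * c z - b z ^ 2) + (b z * f z - c z * e z)) * dx X z
        + (dy e z - dx f z + c z * d z - b z * e z) * dy X z = 0 := by
  have at_two : ∀ {k : ℝ × ℝ → ℝ}, ContDiffOn ℝ ∞ k V → ∀ {w}, w ∈ V → ContDiffAt ℝ 2 k w :=
    fun hk _ hw => (contDiffOn_infty.1 hk 2).contDiffAt (hV.mem_nhds hw)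
  have Xxxy := dx_dy_comm (at_two (contDiffOn_dx hV hX.smooth) hz)
  have Xyyx := dx_dy_comm (at_two (contDiffOn_dy hV hX.smooth) hz)
  rw [eqOn_dx hV hX.dy_dx hz, eqOn_dy hV hX.dx_dx hz] at Xxxy
  rw [eqOn_dx hV hX.dy_dy hz, eqOn_dy hV (fun w hw =>
    (dx_dy_comm (at_two hX.smooth hw)).trans (hX.dy_dx w hw)) hz] at Xyyx
  have h1 := (((hasDerivAt_dx hb).fun_mul (hX.hasDerivAt_dx_dx hV hz)).fun_add
    ((hasDerivAt_dx he).fun_mul (hX.hasDerivAt_dx_dy hV hz))).fun_neg.deriv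
  have h2 := (((hasDerivAt_dy ha).fun_mul (hX.hasDerivAt_dy_dx hV hz)).fun_add
    ((hasDerivAt_dy hd).fun_mul (hX.hasDerivAt_dy_dy hV hz))).fun_neg.deriv
  have h3 := (((hasDerivAt_dx hc).fun_mul (hX.hasDerivAt_dx_dx hV hz)).fun_add
    ((hasDerivAt_dx hf).fun_mul (hX.hasDerivAt_dx_dy hV hz))).fun_neg.deriv
  have h4 := (((hasDerivAt_dy hb).fun_mul (hX.hasDerivAt_dy_dx hV hz)).fun_add
    ((hasDerivAt_dy he).fun_mul (hX.hasDerivAt_dy_dy hV hz))).fun_neg.deriv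
  have e1 := h1.symm.trans (Xxxy.trans h2)
  have e2 := h3.symm.trans (Xyyx.trans h4)
  constructor
  · linear_combination e1
  · linear_combination e2

theorem flat (hX : IsAffineCoordinate V a b c d e f X) (hY : IsAffineCoordinate V a b c d e f Y)
    (hV : IsOpen V) (hJ : ∀ z ∈ V, jacobian X Y z ≠ 0) (ha : DifferentiableOn ℝ a V)
    (hb : DifferentiableOn ℝ b V) (hc : DifferentiableOn ℝ c V) (hd : DifferentiableOn ℝ d V)
    (he : DifferentiableOn ℝ e V) (hf : DifferentiableOn ℝ f V) : Flat V a b c d e f := by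
  intro z hz
  have hVz := hV.mem_nhds hz
  replace ha := ha.differentiableAt hVz
  replace hb := hb.differentiableAt hVz
  replace hc := hc.differentiableAt hVz
  replace hd := hd.differentiableAt hVz
  replace he := he.differentiableAt hVz
  replace hf := hf.differentiableAt hVz
  obtain ⟨hX₁, hX₂⟩ := hX.curvature_apply_eq_zero hV hz ha hb hc hd he hf
  obtain ⟨hY₁, hY₂⟩ := hY.curvature_apply_eq_zero hV hz ha hb hc hd he hf
  obtain ⟨hxx, hxy⟩ := eq_zero_of_jacobian_ne_zero (hJ z hz) hX₁ hY₁
  obtain ⟨hyx, hyy⟩ := eq_zero_of_jacobian_ne_zero (hJ z hz) hX₂ hY₂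
  refine ⟨hxx, hyx, hxy, ?_⟩
  rw [dx_add hb hf, dy_add ha he]
  linear_combination -hxx - hyy

-- The metric is `dX² + dY²`.
theorem metricCompatible (hX : IsAffineCoordinate V a b c d e f X)
    (hY : IsAffineCoordinate V a b c d e f Y) (hV : IsOpen V)
    (hJ : ∀ z ∈ V, jacobian X Y z ≠ 0) :
    MetricCompatible V a b c d e f (fun z => dx X z ^ 2 + dx Y z ^ 2)
      (fun z => dx X z * dy X z + dx Y z * dy Y z) (fun z => dy X z ^ 2 + dy Y z ^ 2) := by
  intro z hz
  have Xxx := hX.hasDerivAt_dx_dx hV hz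
  have Xyx := hX.hasDerivAt_dx_dy hV hz
  have Xxy := hX.hasDerivAt_dy_dx hV hz
  have Xyy := hX.hasDerivAt_dy_dy hV hz
  have Yxx := hY.hasDerivAt_dx_dx hV hz
  have Yyx := hY.hasDerivAt_dx_dy hV hz
  have Yxy := hY.hasDerivAt_dy_dx hV hz
  have Yyy := hY.hasDerivAt_dy_dy hV hz
  have hdet : (dx X z ^ 2 + dx Y z ^ 2) * (dy X z ^ 2 + dy Y z ^ 2)
      - (dx X z * dy X z + dx Y z * dy Y z) ^ 2 = jacobian X Y z ^ 2 := by
    rw [jacobian]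
    ring
  refine ⟨hdet ▸ pow_ne_zero 2 (hJ z hz), ?_, ?_, ?_, ?_, ?_, ?_⟩
  · exact ((Xxx.fun_pow 2).fun_add (Yxx.fun_pow 2)).deriv.trans (by push_cast; ring)
  · exact ((Xxx.fun_mul Xyx).fun_add (Yxx.fun_mul Yyx)).deriv.trans (by ring)
  · exact ((Xyx.fun_pow 2).fun_add (Yyx.fun_pow 2)).deriv.trans (by push_cast; ring)
  · exact ((Xxy.fun_pow 2).fun_add (Yxy.fun_pow 2)).deriv.trans (by push_cast; ring)
  · exact ((Xxy.fun_mul Xyy).fun_add (Yxy.fun_mul Yyy)).deriv.trans (by ring)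
  · exact ((Xyy.fun_pow 2).fun_add (Yyy.fun_pow 2)).deriv.trans (by push_cast; ring)

section Geodesics

variable {E : RootODE} {y : ℝ → ℝ} {x : ℝ}

theorem hasDerivAt_dx_add_dy_mul_deriv (hX : IsAffineCoordinate V a b E.c E.d e f X)
    (hV : IsOpen V) (hz : (x, y x) ∈ V)
    (hh : E.h (x, y x) = a (x, y x) - 2 * e (x, y x))
    (hg : E.g (x, y x) = f (x, y x) - 2 * b (x, y x)) (hy : ContDiffAt ℝ 2 y x) :
    HasDerivAt (fun t => dx X (t, y t) + dy X (t, y t) * deriv y t)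
      (dy X (x, y x) * E.lhs y x - (a (x, y x) + 2 * b (x, y x) * deriv y x
        + E.c (x, y x) * deriv y x ^ 2) * (dx X (x, y x) + dy X (x, y x) * deriv y x)) x := by
  have h₁ : HasDerivAt (deriv y) (iteratedDeriv 2 y x) x := by
    simpa using hasDerivAt_iteratedDeriv (k := 1) hy one_lt_two
  refine (CondLin.hasDerivAt_dx_add_dy_mul_deriv
    ((contDiffOn_infty.1 hX.smooth 2).contDiffAt (hV.mem_nhds hz))
    (hy.differentiableAt two_ne_zero).hasDerivAt h₁).congr_deriv ?_
  rw [hX.dx_dx _ hz, hX.dy_dx _ hz, hX.dy_dy _ hz, RootODE.lhs, hh, hg]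
  ring

theorem transformedSecondDeriv_eq (hX : IsAffineCoordinate V a b E.c E.d e f X)
    (hY : IsAffineCoordinate V a b E.c E.d e f Y) (hV : IsOpen V) (hz : (x, y x) ∈ V)
    (hh : E.h (x, y x) = a (x, y x) - 2 * e (x, y x))
    (hg : E.g (x, y x) = f (x, y x) - 2 * b (x, y x)) (hy : ContDiffAt ℝ 2 y x)
    (hX₀ : deriv (fun s => X (s, y s)) x ≠ 0) :
    transformedSecondDeriv X Y y x =
      jacobian X Y (x, y x) * E.lhs y x / deriv (fun s => X (s, y s)) x ^ 3 := by
  have deriv_comp : ∀ {Z : ℝ × ℝ → ℝ}, ContDiffOn ℝ ∞ Z V → deriv (fun s => Z (s, y s)) =ᶠ[𝓝 x]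
      fun t => dx Z (t, y t) + dy Z (t, y t) * deriv y t := fun hZ => by
    filter_upwards [(continuousAt_id.prodMk hy.continuousAt).eventually (hV.mem_nhds hz),
      hy.eventually (by simp)] with t ht hyt
    exact (hasDerivAt_comp_graph ((hZ.contDiffAt (hV.mem_nhds ht)).differentiableAt (by simp))
      (hyt.differentiableAt two_ne_zero).hasDerivAt).deriv
  have hX' := deriv_comp hX.smooth
  rw [transformedSecondDeriv, ((deriv_comp hY.smooth).fun_div hX').deriv_eq, hX'.eq_of_nhds]
  rw [hX'.eq_of_nhds] at hX₀
  rw [((hY.hasDerivAt_dx_add_dy_mul_deriv hV hz hh hg hy).fun_div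
    (hX.hasDerivAt_dx_add_dy_mul_deriv hV hz hh hg hy) hX₀).deriv, jacobian]
  field_simp
  ring

end Geodesics

end IsAffineCoordinate

/-! ### Linearization -/

theorem jacobian_div {u v w : ℝ × ℝ → ℝ} {z : ℝ × ℝ} (hu : DifferentiableAt ℝ u z)
    (hv : DifferentiableAt ℝ v z) (hw : DifferentiableAt ℝ w z) (h₀ : u z ≠ 0) :
    jacobian (fun z => v z / u z) (fun z => w z / u z) z =
      (u z * jacobian v w z - v z * jacobian u w z + w z * jacobian u v z) / u z ^ 3 := by
  simp only [jacobian, dx_div hv hu h₀, dy_div hv hu h₀, dx_div hw hu h₀, dy_div hw hu h₀]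
  field_simp
  ring

theorem continuousAt_jacobian {X Y : ℝ × ℝ → ℝ} {z : ℝ × ℝ} (hX : ContDiffAt ℝ 1 X z)
    (hY : ContDiffAt ℝ 1 Y z) : ContinuousAt (jacobian X Y) z :=
  have h₁ : (0 : ℕ∞ω) + 1 ≤ 1 := by simp
  ((contDiffAt_dx hX h₁).continuousAt.mul (contDiffAt_dy hY h₁).continuousAt).sub
    ((contDiffAt_dy hX h₁).continuousAt.mul (contDiffAt_dx hY h₁).continuousAt)

theorem exists_mem_nhds_injOn_of_jacobian_ne_zero {X Y : ℝ × ℝ → ℝ} {z₀ : ℝ × ℝ}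
    (hX : ContDiffAt ℝ 1 X z₀) (hY : ContDiffAt ℝ 1 Y z₀) (hJ : jacobian X Y z₀ ≠ 0) :
    ∃ W ∈ 𝓝 z₀, Set.InjOn (fun z => (X z, Y z)) W := by
  let A := (fderiv ℝ X z₀).prod (fderiv ℝ Y z₀)
  have hinj : A.ker = ⊥ := LinearMap.ker_eq_bot'.2 fun v hv => by
    obtain ⟨hXv, hYv⟩ := Prod.ext_iff.1 hv
    simp only [A, ContinuousLinearMap.coe_coe, ContinuousLinearMap.prod_apply,
      fderiv_apply_eq_dx_add_dy (hX.differentiableAt one_ne_zero),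
      fderiv_apply_eq_dx_add_dy (hY.differentiableAt one_ne_zero), Prod.fst_zero,
      Prod.snd_zero, mul_comm (dx _ _), mul_comm (dy _ _)] at hXv hYv
    exact Prod.ext_iff.2 (eq_zero_of_jacobian_ne_zero hJ hXv hYv)
  let A' := ContinuousLinearEquiv.ofBijective A hinj
    (LinearMap.ker_eq_bot_iff_range_eq_top.1 hinj)
  have hA' : HasStrictFDerivAt (fun z => (X z, Y z)) (A' : (ℝ × ℝ) →L[ℝ] ℝ × ℝ) z₀ :=
    ((hX.hasStrictFDerivAt one_ne_zero).prodMk (hY.hasStrictFDerivAt one_ne_zero)).congr_fderiv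
      (ContinuousLinearMap.ext fun _ => rfl)
  exact ⟨_, (hA'.toOpenPartialHomeomorph _).open_source.mem_nhds
    hA'.mem_toOpenPartialHomeomorph_source, (hA'.toOpenPartialHomeomorph _).injOn⟩

namespace RootODE

variable {E : RootODE} {V : Set (ℝ × ℝ)} {u v w : ℝ × ℝ → ℝ}

/-- The coefficient `a` of the affine connection determined by the root equation `E` and the
scale `u`. -/
def connA (E : RootODE) (u : ℝ × ℝ → ℝ) (z : ℝ × ℝ) : ℝ := E.h z / 3 + 2 * dx u z / u z

/-- The coefficient `b` of the affine connection determined by the root equation `E` and the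
scale `u`. -/
def connB (E : RootODE) (u : ℝ × ℝ → ℝ) (z : ℝ × ℝ) : ℝ := dy u z / u z - E.g z / 3

/-- The coefficient `e` of the affine connection determined by the root equation `E` and the
scale `u`. -/
def connE (E : RootODE) (u : ℝ × ℝ → ℝ) (z : ℝ × ℝ) : ℝ := dx u z / u z - E.h z / 3

/-- The coefficient `f` of the affine connection determined by the root equation `E` and the
scale `u`. -/
def connF (E : RootODE) (u : ℝ × ℝ → ℝ) (z : ℝ × ℝ) : ℝ := E.g z / 3 + 2 * dy u z / u z

theorem contDiffOn_conn (hV : IsOpen V) (hh : ContDiffOn ℝ ∞ E.h V) (hg : ContDiffOn ℝ ∞ E.g V)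
    (hu : ContDiffOn ℝ ∞ u V) (h₀ : ∀ z ∈ V, u z ≠ 0) :
    ContDiffOn ℝ ∞ (E.connA u) V ∧ ContDiffOn ℝ ∞ (E.connB u) V ∧
      ContDiffOn ℝ ∞ (E.connE u) V ∧ ContDiffOn ℝ ∞ (E.connF u) V := by
  have hux := contDiffOn_dx hV hu
  have huy := contDiffOn_dy hV hu
  exact ⟨(hh.div_const 3).add ((contDiffOn_const.mul hux).div hu h₀),
    (huy.div hu h₀).sub (hg.div_const 3), (hux.div hu h₀).sub (hh.div_const 3),
    (hg.div_const 3).add ((contDiffOn_const.mul huy).div hu h₀)⟩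

theorem IsFlatScale.congr (hv : E.IsFlatScale V v) (hV : IsOpen V) (h : Set.EqOn u v V) :
    E.IsFlatScale V u := by
  refine ⟨hv.smooth.congr h, fun z hz => ?_, fun z hz => ?_, fun z hz => ?_⟩ <;>
    obtain ⟨h, hx, hy, hxx, hyx, hyy⟩ := partials_eq_of_eqOn hV h hz
  · rw [hxx, h, hx, hy, hv.dx_dx z hz]
  · rw [hyx, h, hx, hy, hv.dy_dx z hz]
  · rw [hyy, h, hx, hy, hv.dy_dy z hz]

theorem IsFlatScale.isAffineCoordinate_of_mul {X : ℝ × ℝ → ℝ} (hu : E.IsFlatScale V u)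
    (hXu : E.IsFlatScale V fun z => X z * u z) (hX : ContDiffOn ℝ ∞ X V) (hV : IsOpen V)
    (h₀ : ∀ z ∈ V, u z ≠ 0) :
    IsAffineCoordinate V (E.connA u) (E.connB u) E.c E.d (E.connE u) (E.connF u) X := by
  have at_two : ∀ {k : ℝ × ℝ → ℝ}, ContDiffOn ℝ ∞ k V → ∀ {z}, z ∈ V → ContDiffAt ℝ 2 k z :=
    fun hk _ hz => (contDiffOn_infty.1 hk 2).contDiffAt (hV.mem_nhds hz)
  refine ⟨hX, fun z hz => ?_, fun z hz => ?_, fun z hz => ?_⟩ <;>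
    have hX2 := at_two hX hz <;>
    have hu2 := at_two hu.smooth hz <;>
    have hX1 := hX2.differentiableAt two_ne_zero <;>
    have hu1 := hu2.differentiableAt two_ne_zero <;>
    have hne := h₀ z hz
  · have h := hXu.dx_dx z hz
    rw [dx_dx_mul hX2 hu2, dx_mul hX1 hu1, dy_mul hX1 hu1, hu.dx_dx z hz] at h
    apply mul_right_cancel₀ hne
    rw [connA]
    field_simp
    linear_combination 3 * h
  · have h := hXu.dy_dx z hz
    rw [dy_dx_mul hX2 hu2, dx_mul hX1 hu1, dy_mul hX1 hu1, hu.dy_dx z hz] at h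
    apply mul_right_cancel₀ hne
    rw [connB, connE]
    field_simp
    linear_combination 3 * h
  · have h := hXu.dy_dy z hz
    rw [dy_dy_mul hX2 hu2, dx_mul hX1 hu1, dy_mul hX1 hu1, hu.dy_dy z hz] at h
    apply mul_right_cancel₀ hne
    rw [connF]
    field_simp
    linear_combination 3 * h

theorem IsFlatScale.isAffineCoordinate_div (hu : E.IsFlatScale V u) (hv : E.IsFlatScale V v)
    (hV : IsOpen V) (h₀ : ∀ z ∈ V, u z ≠ 0) :
    IsAffineCoordinate V (E.connA u) (E.connB u) E.c E.d (E.connE u) (E.connF u)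
      (fun z => v z / u z) :=
  hu.isAffineCoordinate_of_mul
    (hv.congr hV fun z hz => div_mul_cancel₀ (v z) (h₀ z hz))
    (hv.smooth.div hu.smooth h₀) hV h₀

/-- `(X, Y)` is an injective system of affine coordinates on `V` for the connection with Christoffel
symbols `Γ¹₁₁ = -a, Γ¹₁₂ = -b, Γ¹₂₂ = -E.c, Γ²₁₁ = -E.d, Γ²₁₂ = -e, Γ²₂₂ = -f`, whose
unparametrized geodesics are the solutions of the root equation `E`. -/
structure IsFlatChart (E : RootODE) (V : Set (ℝ × ℝ)) (a b e f X Y : ℝ × ℝ → ℝ) : Prop where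
  contDiffOn : ContDiffOn ℝ ∞ a V ∧ ContDiffOn ℝ ∞ b V ∧ ContDiffOn ℝ ∞ e V ∧ ContDiffOn ℝ ∞ f V
  eq_sub : ∀ z ∈ V, E.h z = a z - 2 * e z ∧ E.g z = f z - 2 * b z
  isAffineCoordinate_fst : IsAffineCoordinate V a b E.c E.d e f X
  isAffineCoordinate_snd : IsAffineCoordinate V a b E.c E.d e f Y
  jacobian_ne_zero : ∀ z ∈ V, jacobian X Y z ≠ 0
  injOn : Set.InjOn (fun z => (X z, Y z)) V

theorem IsFlatScale.isFlatChart_div (hu : E.IsFlatScale V u) (hv : E.IsFlatScale V v)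
    (hw : E.IsFlatScale V w) (hV : IsOpen V) (hE : E.SmoothOn V) (h₀ : ∀ z ∈ V, u z ≠ 0)
    (hJ : ∀ z ∈ V, jacobian (fun z => v z / u z) (fun z => w z / u z) z ≠ 0)
    (hinj : Set.InjOn (fun z => (v z / u z, w z / u z)) V) :
    E.IsFlatChart V (E.connA u) (E.connB u) (E.connE u) (E.connF u) (fun z => v z / u z)
      (fun z => w z / u z) where
  contDiffOn := contDiffOn_conn hV hE.2.2.1 hE.2.1 hu.smooth h₀
  eq_sub z _ := by
    simp only [connA, connB, connE, connF]
    constructor <;> ring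
  isAffineCoordinate_fst := hu.isAffineCoordinate_div hv hV h₀
  isAffineCoordinate_snd := hu.isAffineCoordinate_div hw hV h₀
  jacobian_ne_zero := hJ
  injOn := hinj

end RootODE

namespace LieTresse

variable {E : RootODE} {U : Set (ℝ × ℝ)}

theorem exists_isFlatChart (hLT : LieTresse U E) (hU : IsOpen U) (hE : E.SmoothOn U)
    {z₀ : ℝ × ℝ} (hz₀ : z₀ ∈ U) :
    ∃ (V : Set (ℝ × ℝ)) (a b e f X Y : ℝ × ℝ → ℝ), IsOpen V ∧ z₀ ∈ V ∧ V ⊆ U ∧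
      E.IsFlatChart V a b e f X Y := by
  obtain ⟨V, hVU, hV, hzV, hsol⟩ := hLT.exists_forall_isFlatScale hU hE hz₀
  obtain ⟨u, hu, hu₀, hux, huy⟩ := hsol 1 0 0
  obtain ⟨v, hv, hv₀, hvx, hvy⟩ := hsol 0 1 0
  obtain ⟨w, hw, hw₀, hwx, hwy⟩ := hsol 0 0 1
  have at_one : ∀ {k : ℝ × ℝ → ℝ}, E.IsFlatScale V k → ContDiffAt ℝ 1 k z₀ :=
    fun hk => (contDiffOn_infty.1 hk.smooth 1).contDiffAt (hV.mem_nhds hzV)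
  have hne : u z₀ ≠ 0 := hu₀ ▸ one_ne_zero
  have hX := (at_one hv).div (at_one hu) hne
  have hY := (at_one hw).div (at_one hu) hne
  have hJ : jacobian (fun z => v z / u z) (fun z => w z / u z) z₀ ≠ 0 := by
    rw [jacobian_div ((at_one hu).differentiableAt one_ne_zero)
      ((at_one hv).differentiableAt one_ne_zero) ((at_one hw).differentiableAt one_ne_zero) hne]
    simp [jacobian, hu₀, hux, huy, hv₀, hvx, hvy, hw₀, hwx, hwy]
  obtain ⟨W, hW, hinj⟩ := exists_mem_nhds_injOn_of_jacobian_ne_zero hX hY hJ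
  have hev : ∀ᶠ z in 𝓝 z₀, z ∈ V ∧ z ∈ W ∧ u z ≠ 0 ∧
      jacobian (fun z => v z / u z) (fun z => w z / u z) z ≠ 0 :=
    (hV.eventually_mem hzV).and (Eventually.and hW
      (((at_one hu).continuousAt.eventually_ne hne).and
        ((continuousAt_jacobian hX hY).eventually_ne hJ)))
  obtain ⟨V', hV', hV'o, hzV'⟩ := _root_.eventually_nhds_iff.1 hev
  have hV'V : V' ⊆ V := fun z hz => (hV' z hz).1
  exact ⟨V', _, _, _, _, _, _, hV'o, hzV', hV'V.trans hVU,
    (hu.mono hV'V).isFlatChart_div (hv.mono hV'V) (hw.mono hV'V) hV'o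
      (hE.mono (hV'V.trans hVU)) (fun z hz => (hV' z hz).2.2.1) (fun z hz => (hV' z hz).2.2.2)
      (hinj.mono fun z hz => (hV' z hz).2.1)⟩

theorem linearizable (hLT : LieTresse U E) (hU : IsOpen U) (hE : E.SmoothOn U) :
    E.Linearizable U := by
  intro z₀ hz₀
  obtain ⟨V, a, b, e, f, X, Y, hV, hz₀V, hVU, h⟩ := hLT.exists_isFlatChart hU hE hz₀
  refine ⟨V, X, Y, hV, hz₀V, hVU, h.isAffineCoordinate_fst.smooth, h.isAffineCoordinate_snd.smooth,
    h.injOn, h.jacobian_ne_zero, fun y hy x hx hX₀ => ?_⟩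
  rw [h.isAffineCoordinate_fst.transformedSecondDeriv_eq h.isAffineCoordinate_snd hV hx
    (h.eq_sub _ hx).1 (h.eq_sub _ hx).2 (contDiff_infty.1 hy 2).contDiffAt hX₀]
  simp [h.jacobian_ne_zero _ hx, hX₀]

theorem metricConsistent (hLT : LieTresse U E) (hU : IsOpen U) (hE : E.SmoothOn U) :
    MetricConsistent U E := by
  intro z₀ hz₀
  obtain ⟨V, a, b, e, f, X, Y, hV, hz₀V, hVU, h⟩ := hLT.exists_isFlatChart hU hE hz₀
  obtain ⟨ha, hb, he, hf⟩ := h.contDiffOn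
  obtain ⟨hc, -, -, hd⟩ := hE.mono hVU
  have hX := h.isAffineCoordinate_fst
  have hY := h.isAffineCoordinate_snd
  have hXx := contDiffOn_dx hV hX.smooth
  have hXy := contDiffOn_dy hV hX.smooth
  have hYx := contDiffOn_dx hV hY.smooth
  have hYy := contDiffOn_dy hV hY.smooth
  have hdiff : ∀ {k : ℝ × ℝ → ℝ}, ContDiffOn ℝ ∞ k V → DifferentiableOn ℝ k V :=
    fun hk => hk.differentiableOn (by simp)
  exact ⟨V, a, b, e, f, _, _, _, hV, hz₀V, hVU, h.contDiffOn,
    ⟨(hXx.pow 2).add (hYx.pow 2), (hXx.mul hXy).add (hYx.mul hYy), (hXy.pow 2).add (hYy.pow 2)⟩,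
    h.eq_sub, hX.flat hY hV h.jacobian_ne_zero (hdiff ha) (hdiff hb) (hdiff hc) (hdiff hd)
      (hdiff he) (hdiff hf), hX.metricCompatible hY hV h.jacobian_ne_zero⟩

end LieTresse

end CondLin

end

theorem theorem2_general (U : Set (ℝ × ℝ)) (hU : IsOpen U)
    (F : CondLin.QuadODE) (hR₀ : ContinuousOn F.R0 U)
    (E : CondLin.RootODE) (hE : E.SmoothOn U) :
    (CondLin.ArisesFrom U F E ↔
      CondLin.Identification U F E ∧ CondLin.IntegralFormula U F E ∧
        CondLin.Constraints U F E) ∧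
    (CondLin.Identification U F E → CondLin.IntegralFormula U F E →
      CondLin.Constraints U F E → CondLin.LieTresse U E →
        CondLin.ConditionallyLinearizable U F E ∧ CondLin.MetricConsistent U E) ∧
    ((∃ z ∈ U, F.Q1 z ≠ 0 ∨ F.Q0 z ≠ 0) → ¬ CondLin.IsTotalDerivative U F) := by
  refine ⟨CondLin.arisesFrom_iff hU hE hR₀, fun hid hint hcon hLT => ?_,
    CondLin.not_isTotalDerivative hU⟩
  have hcoeff := (CondLin.coeffEqAt_prolongation_iff hU hE hR₀).2 ⟨hid, hint, hcon⟩
  exact ⟨⟨fun I y hy => hy.quadODE hU hE hcoeff, hLT.linearizable hU hE⟩,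
    hLT.metricConsistent hU hE⟩

theorem theorem2 (U : Set (ℝ × ℝ)) (hU : IsOpen U)
    (F : CondLin.QuadODE) (hF : F.SmoothOn U)
    (E : CondLin.RootODE) (hE : E.SmoothOn U) :
    (CondLin.ArisesFrom U F E ↔
      CondLin.Identification U F E ∧ CondLin.IntegralFormula U F E ∧
        CondLin.Constraints U F E) ∧
    (CondLin.Identification U F E → CondLin.IntegralFormula U F E →
      CondLin.Constraints U F E → CondLin.LieTresse U E →
        CondLin.ConditionallyLinearizable U F E ∧ CondLin.MetricConsistent U E) ∧
    ((∃ z ∈ U, F.Q1 z ≠ 0 ∨ F.Q0 z ≠ 0) → ¬ CondLin.IsTotalDerivative U F) :=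
  theorem2_general U hU F hF.2.1.1.continuousOn E hE
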